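/- For a positive integer $q$, a real number $x \ge q$ and a bijection $\gamma$ of $(\mathbb{Z}/q\mathbb{Z})^{\times}$ onto itself, let $$T_\gamma(x;q) = \sum_{\substack{1 \le n_1, n_2 \le x \\ \gcd(n_1 n_2, q) = 1 \\ n_1 \equiv \gamma(n_2) \ (\mathrm{mod}\ q)}} |\mu(n_1)|\,|\mu(n_2)|,$$ where $\mu$ is the Möbius function (so that $T_\gamma(x;q)$ is the number of such pairs with $n_1$ and $n_2$ both squarefree). Let $\varphi$ be Euler's totient function. Then for every $\varepsilon > 0$ there is a constant $C = C(\varepsilon) > 0$, depending only on $\varepsilon$, such that for all integers $q \ge 1$, all real $x \ge q$ and all bijections $\gamma$ of $(\mathbb{Z}/q\mathbb{Z})^{\times}$, $$\left| T_\gamma(x;q) - \frac{1}{\varphi(q)} \Bigg( \sum_{\substack{1 \le n \le x \\ \gcd(n,q)=1}} |\mu(n)| \Bigg)^{2} \right| \le C\, x^{\varepsilon} \left( x^{1/2} q^{1/2} + \frac{x}{q^{1/2}} \right).$$ -/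

import Mathlib

/-- `S(x; q)`: the sum of `|μ(n)|` over the integers `1 ≤ n ≤ x` coprime to `q`. -/
noncomputable def coprimeSqfreeSum (x : ℝ) (q : ℕ) : ℝ :=
  ∑ n ∈ (Finset.Icc 1 ⌊x⌋₊).filter (fun n => n.Coprime q),
    |((ArithmeticFunction.moebius n : ℤ) : ℝ)|

open Classical in
/-- `T_γ(x; q)`: the sum of `|μ(n₁)| |μ(n₂)|` over the pairs of integers `1 ≤ n₁, n₂ ≤ x`
coprime to `q` such that `n₁ = γ(n₂)` in the group of units modulo `q`. -/
noncomputable def twistedPairSum (x : ℝ) (q : ℕ) (γ : Equiv.Perm (ZMod q)ˣ) : ℝ :=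
  ∑ p ∈ (Finset.Icc 1 ⌊x⌋₊ ×ˢ Finset.Icc 1 ⌊x⌋₊).filter
      (fun p : ℕ × ℕ => ∃ (h₁ : p.1.Coprime q) (h₂ : p.2.Coprime q),
        ZMod.unitOfCoprime p.1 h₁ = γ (ZMod.unitOfCoprime p.2 h₂)),
    |((ArithmeticFunction.moebius p.1 : ℤ) : ℝ)| * |((ArithmeticFunction.moebius p.2 : ℤ) : ℝ)|

/-- Coprime pairs in `[1, E]²` whose pairwise determinants are divisible by `L`, below the
diagonal, are few. -/
theorem card_le_of_dvd_det_of_le {E L : ℕ} (hL : 0 < L) (S : Finset (ℕ × ℕ))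
    (hS : ∀ e ∈ S, 1 ≤ e.1 ∧ e.1 ≤ e.2 ∧ e.2 ≤ E ∧ e.1.Coprime e.2)
    (hdet : ∀ e ∈ S, ∀ f ∈ S, (L : ℤ) ∣ (e.1 : ℤ) * f.2 - e.2 * f.1) :
    S.card ≤ E ^ 2 / L + 1 := by
  rw [← Finset.card_range (E ^ 2 / L + 1)]
  refine Finset.card_le_card_of_injOn (fun e => (e.1 * E ^ 2) / (e.2 * L)) ?_ ?_
  · intro e he
    obtain ⟨h1, h2, h3, h4⟩ := hS e he
    simp only [Finset.coe_range, Set.mem_Iio]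
    refine Nat.lt_succ_of_le ?_
    have : (e.1 * E ^ 2) / (e.2 * L) ≤ (e.2 * E ^ 2) / (e.2 * L) :=
      Nat.div_le_div_right (Nat.mul_le_mul_right _ h2)
    rwa [Nat.mul_div_mul_left _ _ (by omega)] at this
  · have key : ∀ e ∈ S, ∀ f ∈ S, (e.1 * E ^ 2) / (e.2 * L) = (f.1 * E ^ 2) / (f.2 * L) →
        (e.1 : ℤ) * f.2 - e.2 * f.1 < L := by
      intro e he f hf hef
      obtain ⟨h1, h2, h3, h4⟩ := hS e he
      obtain ⟨h1', h2', h3', h4'⟩ := hS f hf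
      have a1 : e.1 * E ^ 2 < ((f.1 * E ^ 2) / (f.2 * L) + 1) * (e.2 * L) := by
        rw [← hef]
        have h0 : 0 < e.2 * L := Nat.mul_pos (by omega) hL
        have := Nat.lt_mul_div_succ (e.1 * E ^ 2) h0
        rwa [mul_comm (e.2 * L)] at this
      have a2 : (f.1 * E ^ 2) / (f.2 * L) * (f.2 * L) ≤ f.1 * E ^ 2 := Nat.div_mul_le_self _ _
      set n := (f.1 * E ^ 2) / (f.2 * L)
      have b1 : e.1 * E ^ 2 * f.2 < (n + 1) * (e.2 * L) * f.2 :=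
        Nat.mul_lt_mul_of_pos_right a1 (by omega)
      have b2 : n * (f.2 * L) * e.2 ≤ f.1 * E ^ 2 * e.2 := Nat.mul_le_mul_right _ a2
      have b3 : e.2 * f.2 * L ≤ E ^ 2 * L := by
        rw [sq]; exact Nat.mul_le_mul_right _ (Nat.mul_le_mul h3 h3')
      have b4 : (e.1 * f.2) * E ^ 2 < (e.2 * f.1 + L) * E ^ 2 := by nlinarith
      have b5 := Nat.lt_of_mul_lt_mul_right b4
      zify at b5
      linarith
    intro e he f hf hef
    obtain ⟨h1, h2, h3, h4⟩ := hS e he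
    obtain ⟨h1', h2', h3', h4'⟩ := hS f hf
    have c1 := key e he f hf hef
    have c2 := key f hf e he hef.symm
    have c3 : (e.1 : ℤ) * f.2 - e.2 * f.1 = 0 :=
      Int.eq_zero_of_abs_lt_dvd (hdet e he f hf) (by rw [abs_lt]; constructor <;> linarith)
    have c4 : e.1 * f.2 = e.2 * f.1 := by zify; linarith
    have d1 : e.1 ∣ f.1 := h4.dvd_of_dvd_mul_left (Dvd.intro _ c4)
    have d2 : f.1 ∣ e.1 := h4'.dvd_of_dvd_mul_right (Dvd.intro_left _ c4.symm)
    have d3 : e.1 = f.1 := Nat.dvd_antisymm d1 d2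
    have d4 : e.2 = f.2 := by
      rw [d3, mul_comm] at c4
      exact (Nat.eq_of_mul_eq_mul_right (by omega) c4).symm
    exact Prod.ext d3 d4

theorem card_le_of_dvd_det {E L : ℕ} (hL : 0 < L) (S : Finset (ℕ × ℕ))
    (hS : ∀ e ∈ S, 1 ≤ e.1 ∧ 1 ≤ e.2 ∧ e.1 ≤ E ∧ e.2 ≤ E ∧ e.1.Coprime e.2)
    (hdet : ∀ e ∈ S, ∀ f ∈ S, (L : ℤ) ∣ (e.1 : ℤ) * f.2 - e.2 * f.1) :
    S.card ≤ 2 * (E ^ 2 / L + 1) := by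
  rw [← Finset.card_filter_add_card_filter_not (s := S) (fun e => e.1 ≤ e.2), two_mul]
  refine add_le_add (card_le_of_dvd_det_of_le hL _ ?_ ?_) ?_
  · intro e he
    rw [Finset.mem_filter] at he
    have := hS e he.1
    tauto
  · intro e he f hf
    exact hdet e (Finset.mem_filter.1 he).1 f (Finset.mem_filter.1 hf).1
  · rw [← Finset.card_image_of_injective _ Prod.swap_injective]
    refine card_le_of_dvd_det_of_le hL _ ?_ ?_
    · intro e he
      rw [Finset.mem_image] at he
      obtain ⟨f, hf, rfl⟩ := he
      rw [Finset.mem_filter] at hf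
      obtain ⟨h1, h2, h3, h4, h5⟩ := hS f hf.1
      exact ⟨h2, by simp only [Prod.fst_swap, Prod.snd_swap]; omega, h3, h5.symm⟩
    · intro e he f hf
      rw [Finset.mem_image] at he hf
      obtain ⟨e, he, rfl⟩ := he
      obtain ⟨f, hf, rfl⟩ := hf
      have := hdet f (Finset.mem_filter.1 hf).1 e (Finset.mem_filter.1 he).1
      simp only [Prod.fst_swap, Prod.snd_swap]
      convert this using 1
      ring

/-- Coprime pairs on which a binary quadratic form `u₁ Y² - u₂ X²` vanishes modulo `r`. -/
theorem card_primitive_sq_congr {E r : ℕ} (hr : 0 < r) (u v : ℤ) (hu : IsCoprime u r)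
    (hv : IsCoprime v r) (S : Finset (ℕ × ℕ))
    (hS : ∀ e ∈ S, 1 ≤ e.1 ∧ 1 ≤ e.2 ∧ e.1 ≤ E ∧ e.2 ≤ E ∧ e.1.Coprime e.2)
    (hcop : ∀ e ∈ S, e.1.Coprime r ∧ e.2.Coprime r)
    (hdvd : ∀ e ∈ S, (r : ℤ) ∣ u * (e.2 : ℤ) ^ 2 - v * (e.1 : ℤ) ^ 2) :
    (S.card : ℝ) ≤ r.divisors.card * (2 * (1 + 2 * (E : ℝ) ^ 2 / r)) := by
  rcases S.eq_empty_or_nonempty with rfl | ⟨f, hf⟩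
  · simp only [Finset.card_empty, Nat.cast_zero]; positivity
  obtain ⟨hf1, hf2⟩ := hcop f hf
  have hf1' : IsCoprime (f.1 : ℤ) r := Nat.isCoprime_iff_coprime.2 hf1
  have hf2' : IsCoprime (f.2 : ℤ) r := Nat.isCoprime_iff_coprime.2 hf2
  let g : ℕ × ℕ → ℕ := fun e => Int.gcd ((e.2 : ℤ) * f.1 - e.1 * f.2) r
  have hg : ∀ e ∈ S, g e ∈ r.divisors := fun e _ => by
    rw [Nat.mem_divisors]
    refine ⟨?_, hr.ne'⟩
    exact Int.natCast_dvd_natCast.1 (Int.gcd_dvd_right ((e.2 : ℤ) * f.1 - e.1 * f.2) (r : ℤ))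
  rw [Finset.card_eq_sum_card_fiberwise hg]
  push_cast
  rw [← nsmul_eq_mul]
  refine Finset.sum_le_card_nsmul _ _ _ fun d hd => ?_
  obtain ⟨hdr, -⟩ := Nat.mem_divisors.1 hd
  obtain ⟨s, hs⟩ := hdr
  have hd0 : 0 < d := Nat.pos_of_dvd_of_pos ⟨s, hs⟩ hr
  have hs0 : 0 < s := Nat.pos_of_ne_zero fun h => by simp [h] at hs; omega
  have A : ∀ e ∈ S, g e = d → (d : ℤ) ∣ (e.2 : ℤ) * f.1 - e.1 * f.2 := fun e _ h => by
    have := Int.gcd_dvd_left ((e.2 : ℤ) * f.1 - e.1 * f.2) (r : ℤ)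
    change ((g e : ℕ) : ℤ) ∣ _ at this
    rwa [h] at this
  have B : ∀ e ∈ S, g e = d → (s : ℤ) ∣ (e.2 : ℤ) * f.1 + e.1 * f.2 := fun e he h => by
    have h1 : (r : ℤ) ∣ ((e.2 : ℤ) * f.1 - e.1 * f.2) * (e.2 * f.1 + e.1 * f.2) := by
      have := dvd_sub ((hdvd e he).mul_right (v * (f.1 : ℤ) ^ 2))
        ((hdvd f hf).mul_right (v * (e.1 : ℤ) ^ 2))
      have h2 : (r : ℤ) ∣ (u * v) *
          (((e.2 : ℤ) * f.1 - e.1 * f.2) * (e.2 * f.1 + e.1 * f.2)) := by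
        refine this.trans (dvd_of_eq ?_); ring
      exact (IsCoprime.mul_left hu hv).symm.dvd_of_dvd_mul_left h2
    obtain ⟨w, hw⟩ := A e he h
    have h3 : IsCoprime (w : ℤ) s := by
      have h4 : Int.gcd ((d : ℤ) * w) (d * s) = d := by
        have : (r : ℤ) = d * s := by rw [hs, Nat.cast_mul]
        rw [← hw, ← this]; exact h
      rw [Int.gcd_mul_left] at h4
      rw [Int.isCoprime_iff_gcd_eq_one]
      simp only [Int.natAbs_natCast] at h4
      exact Nat.eq_of_mul_eq_mul_left hd0 (by rw [h4, mul_one])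
    rw [hw, hs, Nat.cast_mul, mul_assoc] at h1
    have h5 := Int.dvd_of_mul_dvd_mul_left (by exact_mod_cast hd0.ne') h1
    exact h3.symm.dvd_of_dvd_mul_left h5
  have hdc : IsCoprime (d : ℤ) ((f.1 : ℤ) * f.2) := by
    have : (d : ℤ) ∣ r := by rw [hs]; push_cast; exact Dvd.intro _ rfl
    exact ((IsCoprime.mul_left hf1' hf2').of_isCoprime_of_dvd_right this).symm
  have hsc : IsCoprime (s : ℤ) ((f.1 : ℤ) * f.2) := by
    have : (s : ℤ) ∣ r := by rw [hs]; push_cast; exact Dvd.intro_left _ rfl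
    exact ((IsCoprime.mul_left hf1' hf2').of_isCoprime_of_dvd_right this).symm
  rcases (S.filter fun e => g e = d).eq_empty_or_nonempty with hE | ⟨e₀, he₀⟩
  · rw [hE]; simp only [Finset.card_empty, Nat.cast_zero]; positivity
  have hlcm : r ≤ 2 * Nat.lcm d s := by
    rw [Finset.mem_filter] at he₀
    have h1 : ((Nat.gcd d s : ℕ) : ℤ) ∣ 2 * ((e₀.2 : ℤ) * f.1) := by
      have h2 := (Int.natCast_dvd_natCast.2 (Nat.gcd_dvd_left d s)).trans (A e₀ he₀.1 he₀.2)
      have h3 := (Int.natCast_dvd_natCast.2 (Nat.gcd_dvd_right d s)).trans (B e₀ he₀.1 he₀.2)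
      refine (dvd_add h2 h3).trans (dvd_of_eq ?_); ring
    have h2 : IsCoprime ((Nat.gcd d s : ℕ) : ℤ) ((e₀.2 : ℤ) * f.1) := by
      have : ((Nat.gcd d s : ℕ) : ℤ) ∣ r :=
        Int.natCast_dvd_natCast.2 ((Nat.gcd_dvd_left d s).trans ⟨s, hs⟩)
      exact ((IsCoprime.mul_left (Nat.isCoprime_iff_coprime.2 (hcop e₀ he₀.1).2)
        hf1').of_isCoprime_of_dvd_right this).symm
    have h3 : Nat.gcd d s ∣ 2 := by exact_mod_cast h2.dvd_of_dvd_mul_right h1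
    have h4 := Nat.le_of_dvd two_pos h3
    rw [hs, ← Nat.gcd_mul_lcm d s]
    exact Nat.mul_le_mul_right _ h4
  have hl0 : 0 < Nat.lcm d s := Nat.lcm_pos hd0 hs0
  have hb := card_le_of_dvd_det (E := E) hl0 (S.filter fun e => g e = d)
    (fun e he => hS e (Finset.mem_filter.1 he).1) (by
      intro e he e' he'
      rw [Finset.mem_filter] at he he'
      have hd1 : (d : ℤ) ∣ (e.1 : ℤ) * e'.2 - e.2 * e'.1 := by
        have := dvd_sub ((A e' he'.1 he'.2).mul_right ((e.1 : ℤ) * f.2))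
          ((A e he.1 he.2).mul_right ((e'.1 : ℤ) * f.2))
        refine hdc.dvd_of_dvd_mul_left ?_
        convert this using 1; ring
      have hs1 : (s : ℤ) ∣ (e.1 : ℤ) * e'.2 - e.2 * e'.1 := by
        have := dvd_sub ((B e' he'.1 he'.2).mul_right ((e.1 : ℤ) * f.2))
          ((B e he.1 he.2).mul_right ((e'.1 : ℤ) * f.2))
        refine hsc.dvd_of_dvd_mul_left ?_
        convert this using 1; ring
      rw [Int.natCast_dvd] at hd1 hs1 ⊢
      exact Nat.lcm_dvd hd1 hs1)
  have hb' : ((S.filter fun e => g e = d).card : ℝ) ≤ 2 * ((E ^ 2 / Nat.lcm d s : ℕ) + 1) := by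
    exact_mod_cast hb
  have hc : ((E ^ 2 / Nat.lcm d s : ℕ) : ℝ) ≤ 2 * (E : ℝ) ^ 2 / r := by
    refine Nat.cast_div_le.trans ?_
    rw [div_le_div_iff₀ (by exact_mod_cast hl0) (by exact_mod_cast hr)]
    have : (r : ℝ) ≤ 2 * (Nat.lcm d s : ℕ) := by exact_mod_cast hlcm
    push_cast
    nlinarith [sq_nonneg (E : ℝ)]
  linarith

/-- Quadruples `((k₁, k₂), (d₁, d₂))` with `0 < |kᵢ| ≤ K`, `1 ≤ dᵢ ≤ D`, the `dᵢ` coprime to `q`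
and `k₁ d₂² ≡ k₂ d₁² (mod q)`. -/
noncomputable def sqCongrQuads (q K D : ℕ) : Finset ((ℤ × ℤ) × (ℕ × ℕ)) :=
  ((Finset.Icc (-K : ℤ) K ×ˢ Finset.Icc (-K : ℤ) K) ×ˢ
    (Finset.Icc 1 D ×ˢ Finset.Icc 1 D)).filter fun p =>
      p.1.1 ≠ 0 ∧ p.1.2 ≠ 0 ∧ p.2.1.Coprime q ∧ p.2.2.Coprime q ∧
        (q : ℤ) ∣ p.1.1 * (p.2.2 : ℤ) ^ 2 - p.1.2 * (p.2.1 : ℤ) ^ 2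

theorem mem_sqCongrQuads {q K D : ℕ} {p : (ℤ × ℤ) × (ℕ × ℕ)} :
    p ∈ sqCongrQuads q K D ↔
      ((-K ≤ p.1.1 ∧ p.1.1 ≤ K) ∧ -K ≤ p.1.2 ∧ p.1.2 ≤ K) ∧
      ((1 ≤ p.2.1 ∧ p.2.1 ≤ D) ∧ 1 ≤ p.2.2 ∧ p.2.2 ≤ D) ∧
      p.1.1 ≠ 0 ∧ p.1.2 ≠ 0 ∧ p.2.1.Coprime q ∧ p.2.2.Coprime q ∧
        (q : ℤ) ∣ p.1.1 * (p.2.2 : ℤ) ^ 2 - p.1.2 * (p.2.1 : ℤ) ^ 2 := by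
  simp only [sqCongrQuads, Finset.mem_filter, Finset.mem_product, Finset.mem_Icc, and_assoc]

/-- The quadruples of `sqCongrQuads` with `d₁` and `d₂` coprime. -/
noncomputable def primSqCongrQuads (q K D : ℕ) : Finset ((ℤ × ℤ) × (ℕ × ℕ)) :=
  (sqCongrQuads q K D).filter fun p => p.2.1.Coprime p.2.2

theorem card_nonzero_multiples_le (K t : ℕ) (ht : 0 < t) :
    (((Finset.Icc (-K : ℤ) K).filter fun k => k ≠ 0 ∧ (t : ℤ) ∣ k).card : ℝ) ≤ 2 * K / t := by
  have hsub : ((Finset.Icc (-K : ℤ) K).filter fun k => k ≠ 0 ∧ (t : ℤ) ∣ k) ⊆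
      ((Finset.Icc (-(K / t : ℕ) : ℤ) (K / t : ℕ)).erase 0).image (fun j => (t : ℤ) * j) := by
    intro k hk
    rw [Finset.mem_filter, Finset.mem_Icc] at hk
    obtain ⟨⟨h1, h2⟩, h3, j, rfl⟩ := hk
    rw [Finset.mem_image]
    refine ⟨j, ?_, rfl⟩
    rw [Finset.mem_erase, Finset.mem_Icc]
    have ht' : (0 : ℤ) < t := by exact_mod_cast ht
    refine ⟨fun h => h3 (by rw [h, mul_zero]), ?_, ?_⟩
    · push_cast
      have : -j ≤ (K : ℤ) / t := by rw [Int.le_ediv_iff_mul_le ht']; linarith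
      linarith
    · push_cast
      rw [Int.le_ediv_iff_mul_le ht']; linarith
  have hc : ((Finset.Icc (-(K / t : ℕ) : ℤ) (K / t : ℕ)).erase 0).card = 2 * (K / t) := by
    rw [Finset.card_erase_of_mem (Finset.mem_Icc.2
      ⟨neg_nonpos.2 (Int.natCast_nonneg _), Int.natCast_nonneg _⟩), Int.card_Icc]
    omega
  have h1 := (Finset.card_le_card hsub).trans Finset.card_image_le
  rw [hc] at h1
  calc _ ≤ ((2 * (K / t) : ℕ) : ℝ) := by exact_mod_cast h1
    _ = 2 * ((K / t : ℕ) : ℝ) := by push_cast; ring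
    _ ≤ 2 * ((K : ℝ) / t) := by exact mul_le_mul_of_nonneg_left Nat.cast_div_le two_pos.le
    _ = _ := by ring

theorem card_primSqCongrQuads_fiber_le {q K E t : ℕ} (hq : 0 < q) (ht : t ∈ q.divisors) :
    (((primSqCongrQuads q K E).filter fun p => Int.gcd p.1.1 q = t).card : ℝ) ≤
      (2 * K / t) ^ 2 * (q.divisors.card * (2 * (1 + 2 * (E : ℝ) ^ 2 * t / q))) := by
  obtain ⟨r, hr⟩ := (Nat.mem_divisors.1 ht).1
  have ht0 : 0 < t := Nat.pos_of_mem_divisors ht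
  have hr0 : 0 < r := Nat.pos_of_ne_zero fun h => by simp [h] at hr; omega
  set A := (Finset.Icc (-K : ℤ) K).filter fun k => k ≠ 0 ∧ (t : ℤ) ∣ k with hA
  have hgcd : ∀ p ∈ (primSqCongrQuads q K E).filter fun p => Int.gcd p.1.1 q = t,
      Int.gcd p.1.2 q = t := by
    intro p hp
    rw [Finset.mem_filter, primSqCongrQuads, Finset.mem_filter, mem_sqCongrQuads] at hp
    obtain ⟨⟨⟨-, -, -, -, h1, h2, h3⟩, -⟩, h4⟩ := hp
    rw [← h4]
    have e1 : Int.gcd (p.1.1 * (p.2.2 : ℤ) ^ 2) q = Int.gcd p.1.1 q := by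
      rw [mul_comm]
      exact Int.gcd_mul_right_left_of_gcd_eq_one (by
        rw [← Int.isCoprime_iff_gcd_eq_one]
        exact (Nat.isCoprime_iff_coprime.2 h2).pow_left)
    have e2 : Int.gcd (p.1.2 * (p.2.1 : ℤ) ^ 2) q = Int.gcd p.1.2 q := by
      rw [mul_comm]
      exact Int.gcd_mul_right_left_of_gcd_eq_one (by
        rw [← Int.isCoprime_iff_gcd_eq_one]
        exact (Nat.isCoprime_iff_coprime.2 h1).pow_left)
    rw [← e1, ← e2]
    obtain ⟨w, hw⟩ := h3
    rw [show p.1.2 * (p.2.1 : ℤ) ^ 2 = p.1.1 * (p.2.2 : ℤ) ^ 2 + q * (-w) by linarith,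
      Int.gcd_add_mul_left_left]
  have hmap : ∀ p ∈ (primSqCongrQuads q K E).filter fun p => Int.gcd p.1.1 q = t,
      p.1 ∈ A ×ˢ A := by
    intro p hp
    have h' := hgcd p hp
    rw [Finset.mem_filter, primSqCongrQuads, Finset.mem_filter, mem_sqCongrQuads] at hp
    obtain ⟨⟨⟨⟨h1, h2⟩, -, h3, h4, -⟩, -⟩, h5⟩ := hp
    rw [Finset.mem_product, hA, Finset.mem_filter, Finset.mem_filter, Finset.mem_Icc,
      Finset.mem_Icc]
    exact ⟨⟨h1, h3, h5 ▸ Int.gcd_dvd_left _ _⟩, h2, h4, h' ▸ Int.gcd_dvd_left _ _⟩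
  rw [Finset.card_eq_sum_card_fiberwise hmap]
  push_cast
  have hAc : (((A ×ˢ A).card : ℕ) : ℝ) ≤ (2 * K / t) ^ 2 := by
    rw [Finset.card_product, Nat.cast_mul, ← sq]
    exact pow_le_pow_left₀ (by positivity) (card_nonzero_multiples_le K t ht0) 2
  have hB : (0 : ℝ) ≤ q.divisors.card * (2 * (1 + 2 * (E : ℝ) ^ 2 * t / q)) := by positivity
  refine (Finset.sum_le_card_nsmul _ _ (q.divisors.card * (2 * (1 + 2 * (E : ℝ) ^ 2 * t / q)))
    fun k hk => ?_).trans ?_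
  · rcases (((primSqCongrQuads q K E).filter fun p => Int.gcd p.1.1 q = t).filter
        fun p => p.1 = k).eq_empty_or_nonempty with h0 | ⟨p₀, hp₀⟩
    · rw [h0]; simpa using hB
    rw [Finset.mem_filter] at hp₀
    have hk1 : Int.gcd k.1 q = t := hp₀.2 ▸ (Finset.mem_filter.1 hp₀.1).2
    have hk2 : Int.gcd k.2 q = t := hp₀.2 ▸ hgcd p₀ hp₀.1
    obtain ⟨u, hu⟩ : (t : ℤ) ∣ k.1 := hk1 ▸ Int.gcd_dvd_left _ _
    obtain ⟨v, hv⟩ : (t : ℤ) ∣ k.2 := hk2 ▸ Int.gcd_dvd_left _ _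
    have hcop : ∀ w : ℤ, Int.gcd (t * w) q = t → IsCoprime w r := by
      intro w hw
      rw [hr, Nat.cast_mul, Int.gcd_mul_left, Int.natAbs_natCast] at hw
      rw [Int.isCoprime_iff_gcd_eq_one]
      exact Nat.eq_of_mul_eq_mul_left ht0 (by rw [hw, mul_one])
    rw [← Finset.card_image_of_injOn (f := Prod.snd) (by
      intro a ha b hb hab
      rw [Finset.mem_coe, Finset.mem_filter] at ha hb
      exact Prod.ext (ha.2.trans hb.2.symm) hab)]
    have key := card_primitive_sq_congr (E := E) hr0 u v (hcop u (hu ▸ hk1)) (hcop v (hv ▸ hk2))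
      ((((primSqCongrQuads q K E).filter fun p => Int.gcd p.1.1 q = t).filter
        fun p => p.1 = k).image Prod.snd) (by
          intro e he
          obtain ⟨p, hp, rfl⟩ := Finset.mem_image.1 he
          simp only [Finset.mem_filter, primSqCongrQuads, mem_sqCongrQuads] at hp
          tauto) (by
          intro e he
          obtain ⟨p, hp, rfl⟩ := Finset.mem_image.1 he
          simp only [Finset.mem_filter, primSqCongrQuads, mem_sqCongrQuads] at hp
          obtain ⟨⟨⟨⟨-, -, -, -, h1, h2, -⟩, -⟩, -⟩, -⟩ := hp
          exact ⟨h1.coprime_dvd_right (hr ▸ Dvd.intro_left _ rfl),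
            h2.coprime_dvd_right (hr ▸ Dvd.intro_left _ rfl)⟩) (by
          intro e he
          obtain ⟨p, hp, rfl⟩ := Finset.mem_image.1 he
          simp only [Finset.mem_filter, primSqCongrQuads, mem_sqCongrQuads] at hp
          obtain ⟨⟨⟨⟨-, -, -, -, -, -, h1⟩, -⟩, -⟩, h2⟩ := hp
          rw [h2, hu, hv, hr, Nat.cast_mul, mul_assoc, mul_assoc, ← mul_sub] at h1
          exact Int.dvd_of_mul_dvd_mul_left (by exact_mod_cast ht0.ne') h1)
    refine key.trans ?_
    have hrq : (E : ℝ) ^ 2 / r = (E : ℝ) ^ 2 * t / q := by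
      rw [hr]; push_cast
      have : (t : ℝ) ≠ 0 := by exact_mod_cast ht0.ne'
      have : (r : ℝ) ≠ 0 := by exact_mod_cast hr0.ne'
      field_simp
    rw [mul_div_assoc, hrq, ← mul_div_assoc, ← mul_assoc 2 ((E : ℝ) ^ 2)]
    gcongr
    exact hr ▸ Dvd.intro_left _ rfl
  · rw [nsmul_eq_mul]
    exact mul_le_mul_of_nonneg_right hAc hB

theorem card_primSqCongrQuads_le {q K E : ℕ} (hq : 0 < q) :
    ((primSqCongrQuads q K E).card : ℝ) ≤
      8 * (q.divisors.card : ℝ) ^ 2 * (K : ℝ) ^ 2 * (1 + 2 * (E : ℝ) ^ 2 / q) := by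
  have hmap : ∀ p ∈ primSqCongrQuads q K E, Int.gcd p.1.1 q ∈ q.divisors := fun p _ =>
    Nat.mem_divisors.2 ⟨Int.natCast_dvd_natCast.1 (Int.gcd_dvd_right _ _), hq.ne'⟩
  rw [Finset.card_eq_sum_card_fiberwise hmap]
  push_cast
  refine (Finset.sum_le_card_nsmul _ _
    (8 * (q.divisors.card : ℝ) * (K : ℝ) ^ 2 * (1 + 2 * (E : ℝ) ^ 2 / q)) fun t ht => ?_).trans ?_
  · refine (card_primSqCongrQuads_fiber_le hq ht).trans ?_
    have ht1 : (1 : ℝ) ≤ t := by exact_mod_cast Nat.pos_of_mem_divisors ht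
    have hq' : (0 : ℝ) < q := by exact_mod_cast hq
    have e : (2 * K / t : ℝ) ^ 2 * (q.divisors.card * (2 * (1 + 2 * (E : ℝ) ^ 2 * t / q))) =
        8 * (q.divisors.card : ℝ) * (K : ℝ) ^ 2 *
          (1 / (t : ℝ) ^ 2 + 2 * (E : ℝ) ^ 2 / q * (1 / t)) := by
      field_simp
      ring
    rw [e]
    have h1 : 1 / (t : ℝ) ^ 2 ≤ 1 := by
      rw [div_le_one (by positivity)]; exact one_le_pow₀ ht1
    have h2 : 1 / (t : ℝ) ≤ 1 := by
      rw [div_le_one (by positivity)]; exact ht1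
    gcongr
    exact mul_le_of_le_one_right (by positivity) h2
  · rw [nsmul_eq_mul]
    apply le_of_eq; ring

theorem card_primSqCongrQuads_le_mul {q K E : ℕ} (hq : 0 < q) (hK : K ≤ q) :
    ((primSqCongrQuads q K E).card : ℝ) ≤ 6 * (K : ℝ) * (E : ℝ) ^ 2 := by
  set T := (Finset.Icc (-1 : ℤ) 1) ×ˢ ((Finset.Icc (-K : ℤ) K).filter
    fun k => k ≠ 0 ∧ ((1 : ℕ) : ℤ) ∣ k) ×ˢ (Finset.Icc 1 E ×ˢ Finset.Icc 1 E) with hT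
  have hcard : (primSqCongrQuads q K E).card ≤ T.card := by
    refine Finset.card_le_card_of_injOn (fun p => (p.1.1 / q, p.1.2, p.2)) ?_ ?_
    · intro p hp
      rw [Finset.mem_coe, primSqCongrQuads, Finset.mem_filter, mem_sqCongrQuads] at hp
      obtain ⟨⟨⟨h1, h2⟩, ⟨h3, h4⟩, h5, h6, -⟩, -⟩ := hp
      simp only [hT, Finset.coe_product, Set.mem_prod, Finset.mem_coe, Finset.mem_Icc,
        Finset.mem_filter, Nat.cast_one, one_dvd, and_true]
      have hq' : (0 : ℤ) < q := by exact_mod_cast hq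
      have hK' : (K : ℤ) ≤ q := by exact_mod_cast hK
      refine ⟨⟨?_, ?_⟩, ⟨h2, h6⟩, h3, h4⟩
      · rw [Int.le_ediv_iff_mul_le hq']; linarith
      · exact Int.lt_add_one_iff.1 ((Int.ediv_lt_iff_lt_mul hq').2 (by linarith))
    · intro p hp p' hp' h
      rw [Finset.mem_coe, primSqCongrQuads, Finset.mem_filter, mem_sqCongrQuads] at hp hp'
      obtain ⟨⟨-, -, -, -, -, h1, h2⟩, -⟩ := hp
      obtain ⟨⟨-, -, -, -, -, -, h2'⟩, -⟩ := hp'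
      simp only [Prod.mk.injEq] at h
      obtain ⟨e1, e2, e3⟩ := h
      rw [← e2, ← e3] at h2'
      have h3 : (q : ℤ) ∣ (p.2.2 : ℤ) ^ 2 * (p.1.1 - p'.1.1) := by
        refine (dvd_sub h2 h2').trans (dvd_of_eq ?_); ring
      have h4 : (q : ℤ) ∣ p.1.1 - p'.1.1 :=
        (Nat.isCoprime_iff_coprime.2 h1).pow_left.symm.dvd_of_dvd_mul_left h3
      have h5 : p.1.1 % q = p'.1.1 % q := 
        Int.emod_eq_emod_iff_emod_sub_eq_zero.2 (Int.emod_eq_zero_of_dvd h4)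
      have h6 : p.1.1 = p'.1.1 := by
        rw [← Int.mul_ediv_add_emod p.1.1 q, ← Int.mul_ediv_add_emod p'.1.1 q, e1, h5]
      exact Prod.ext (Prod.ext h6 e2) e3
  have hTc : (T.card : ℝ) ≤ 6 * (K : ℝ) * (E : ℝ) ^ 2 := by
    have h1 := card_nonzero_multiples_le K 1 one_pos
    rw [hT, Finset.card_product, Finset.card_product, Finset.card_product]
    simp only [Int.card_Icc, Nat.card_Icc]
    push_cast at h1 ⊢
    rw [div_one] at h1
    have h2 := mul_le_mul_of_nonneg_right h1 (sq_nonneg (E : ℝ))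
    norm_num at h2 ⊢
    linarith [h2, sq (E : ℝ)]
  exact (by exact_mod_cast hcard : ((primSqCongrQuads q K E).card : ℝ) ≤ T.card).trans hTc

theorem card_primSqCongrQuads_le_sqrt {q K E : ℕ} (hq : 0 < q) (hK : K ≤ q) :
    ((primSqCongrQuads q K E).card : ℝ) ≤
      16 * (q.divisors.card : ℝ) ^ 2 * ((K : ℝ) ^ 2 * (E : ℝ) ^ 2 / q + K * √K * E) := by
  have h1 := card_primSqCongrQuads_le (K := K) (E := E) hq
  have h2 := card_primSqCongrQuads_le_mul (E := E) hq hK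
  have hq' : (0 : ℝ) < q := by exact_mod_cast hq
  have hτ : (1 : ℝ) ≤ q.divisors.card := by
    exact_mod_cast Finset.card_pos.2 ⟨1, Nat.one_mem_divisors.2 hq.ne'⟩
  generalize (q.divisors.card : ℝ) = τ at *
  obtain ⟨s, hs⟩ : ∃ s, s = √(K : ℝ) := ⟨_, rfl⟩
  have hs0 : 0 ≤ s := hs ▸ Real.sqrt_nonneg _
  have hK2 : (K : ℝ) = s ^ 2 := by rw [hs, Real.sq_sqrt (Nat.cast_nonneg K)]
  rw [← hs]
  rw [hK2] at h1 h2 ⊢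
  have hE : (0 : ℝ) ≤ E := Nat.cast_nonneg E
  have hx : 8 * τ ^ 2 * (s ^ 2) ^ 2 * (1 + 2 * (E : ℝ) ^ 2 / q) =
    8 * τ ^ 2 * s ^ 4 + 16 * τ ^ 2 * ((s ^ 2) ^ 2 * (E : ℝ) ^ 2 / q) := by field_simp; ring
  rw [hx] at h1
  have h0 : 0 ≤ 16 * τ ^ 2 * ((s ^ 2) ^ 2 * (E : ℝ) ^ 2 / q) := by positivity
  rw [mul_add]
  rcases le_total s E with h | h
  · have : s ^ 4 ≤ s ^ 2 * s * E := by
      calc s ^ 4 = s ^ 3 * s := by ring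
        _ ≤ s ^ 3 * E := by gcongr
        _ = _ := by ring
    have h3 : 8 * τ ^ 2 * s ^ 4 ≤ 8 * τ ^ 2 * (s ^ 2 * s * E) := by gcongr
    have : 0 ≤ τ ^ 2 * (s ^ 2 * s * E) := by positivity
    linarith
  · have h3 : s ^ 2 * (E : ℝ) ^ 2 ≤ s ^ 2 * s * E := by
      calc s ^ 2 * (E : ℝ) ^ 2 = s ^ 2 * E * E := by ring
        _ ≤ s ^ 2 * E * s := by gcongr
        _ = _ := by ring
    have h4 : 1 * (s ^ 2 * s * E) ≤ τ ^ 2 * (s ^ 2 * s * E) := by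
      gcongr; exact one_le_pow₀ hτ
    have : 0 ≤ (s ^ 2 * s * E) := by positivity
    linarith

theorem card_sqCongrQuads_le_sum {q K D : ℕ} :
    (sqCongrQuads q K D).card ≤
      ∑ g ∈ Finset.Icc 1 D, (primSqCongrQuads q K (D / g)).card := by
  have hmap : ∀ p ∈ sqCongrQuads q K D, Nat.gcd p.2.1 p.2.2 ∈ Finset.Icc 1 D := by
    intro p hp
    rw [mem_sqCongrQuads] at hp
    rw [Finset.mem_Icc]
    exact ⟨Nat.gcd_pos_of_pos_left _ hp.2.1.1.1,
      (Nat.gcd_le_left _ hp.2.1.1.1).trans hp.2.1.1.2⟩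
  rw [Finset.card_eq_sum_card_fiberwise hmap]
  refine Finset.sum_le_sum fun g hg => ?_
  have hg0 : 0 < g := (Finset.mem_Icc.1 hg).1
  refine Finset.card_le_card_of_injOn (fun p => (p.1, (p.2.1 / g, p.2.2 / g))) ?_ ?_
  · rintro ⟨⟨k₁, k₂⟩, d₁, d₂⟩ hp
    rw [Finset.mem_coe, Finset.mem_filter, mem_sqCongrQuads] at hp
    obtain ⟨⟨hk, ⟨⟨a1, a2⟩, a3, a4⟩, b1, b2, b3, b4, b5⟩, hgg⟩ := hp
    simp only at hgg a1 a2 a3 a4 b1 b2 b3 b4 b5 hk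
    obtain ⟨e₁, he₁⟩ : g ∣ d₁ := hgg ▸ Nat.gcd_dvd_left _ _
    obtain ⟨e₂, he₂⟩ : g ∣ d₂ := hgg ▸ Nat.gcd_dvd_right _ _
    subst he₁ he₂
    simp only [Finset.mem_coe, primSqCongrQuads, Finset.mem_filter, mem_sqCongrQuads,
      Nat.mul_div_cancel_left _ hg0]
    have hgq : Nat.Coprime g q := Nat.Coprime.coprime_mul_right b3
    refine ⟨⟨hk, ⟨⟨?_, ?_⟩, ?_, ?_⟩, b1, b2, Nat.Coprime.coprime_mul_left b3,
      Nat.Coprime.coprime_mul_left b4, ?_⟩, ?_⟩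
    · exact Nat.pos_of_ne_zero fun h => by simp [h] at a1
    · rw [Nat.le_div_iff_mul_le hg0]; linarith
    · exact Nat.pos_of_ne_zero fun h => by simp [h] at a3
    · rw [Nat.le_div_iff_mul_le hg0]; linarith
    · have : (q : ℤ) ∣ (g : ℤ) ^ 2 * (k₁ * (e₂ : ℤ) ^ 2 - k₂ * (e₁ : ℤ) ^ 2) := by
        refine b5.trans (dvd_of_eq ?_); push_cast; ring
      exact (Nat.isCoprime_iff_coprime.2 hgq).pow_left.symm.dvd_of_dvd_mul_left this
    · rw [Nat.gcd_mul_left] at hgg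
      exact Nat.eq_of_mul_eq_mul_left hg0 (by rw [hgg, mul_one])
  · rintro ⟨k, d₁, d₂⟩ hp ⟨k', d₁', d₂'⟩ hp' h
    rw [Finset.mem_coe, Finset.mem_filter] at hp hp'
    have h1 := hp.2
    have h2 := hp'.2
    simp only at h1 h2
    simp only [Prod.mk.injEq] at h ⊢
    obtain ⟨c1, c2, c3⟩ := h
    refine ⟨c1, ?_, ?_⟩
    · rw [← Nat.mul_div_cancel' (h1 ▸ Nat.gcd_dvd_left d₁ d₂ : g ∣ d₁), c2,
        Nat.mul_div_cancel' (h2 ▸ Nat.gcd_dvd_left d₁' d₂' : g ∣ d₁')]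
    · rw [← Nat.mul_div_cancel' (h1 ▸ Nat.gcd_dvd_right d₁ d₂ : g ∣ d₂), c3,
        Nat.mul_div_cancel' (h2 ▸ Nat.gcd_dvd_right d₁' d₂' : g ∣ d₂')]

theorem card_sqCongrQuads_le {q K D : ℕ} (hq : 0 < q) (hK : K ≤ q) :
    ((sqCongrQuads q K D).card : ℝ) ≤
      16 * (q.divisors.card : ℝ) ^ 2 * (1 + Real.log D) *
        ((K : ℝ) ^ 2 * (D : ℝ) ^ 2 / q + K * √K * D) := by
  have h1 : ((sqCongrQuads q K D).card : ℝ) ≤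
      ∑ g ∈ Finset.Icc 1 D, ((primSqCongrQuads q K (D / g)).card : ℝ) := by
    exact_mod_cast card_sqCongrQuads_le_sum
  have h2 : ∀ g ∈ Finset.Icc 1 D, ((primSqCongrQuads q K (D / g)).card : ℝ) ≤
      16 * (q.divisors.card : ℝ) ^ 2 * ((K : ℝ) ^ 2 * (D : ℝ) ^ 2 / q + K * √K * D) *
        (g : ℝ)⁻¹ := by
    intro g hg
    have hg1 : (1 : ℝ) ≤ g := by exact_mod_cast (Finset.mem_Icc.1 hg).1
    refine (card_primSqCongrQuads_le_sqrt hq hK).trans ?_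
    rw [mul_assoc _ (_ + _)]
    gcongr 16 * (q.divisors.card : ℝ) ^ 2 * ?_
    have hdg : ((D / g : ℕ) : ℝ) ≤ D * (g : ℝ)⁻¹ := by
      rw [← div_eq_mul_inv]; exact Nat.cast_div_le
    have hi : (g : ℝ)⁻¹ ≤ 1 := inv_le_one_of_one_le₀ hg1
    have hi0 : 0 < (g : ℝ)⁻¹ := by positivity
    have hsq : ((D / g : ℕ) : ℝ) ^ 2 ≤ D ^ 2 * (g : ℝ)⁻¹ := by
      calc ((D / g : ℕ) : ℝ) ^ 2 ≤ (D * (g : ℝ)⁻¹) ^ 2 := by gcongr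
        _ = D ^ 2 * (g : ℝ)⁻¹ * (g : ℝ)⁻¹ := by ring
        _ ≤ D ^ 2 * (g : ℝ)⁻¹ * 1 := by gcongr
        _ = _ := by ring
    calc (K : ℝ) ^ 2 * ((D / g : ℕ) : ℝ) ^ 2 / q + K * √K * ((D / g : ℕ) : ℝ)
        ≤ (K : ℝ) ^ 2 * (D ^ 2 * (g : ℝ)⁻¹) / q + K * √K * (D * (g : ℝ)⁻¹) := by gcongr
      _ = _ := by ring
  refine h1.trans ((Finset.sum_le_sum h2).trans ?_)
  rw [← Finset.mul_sum]
  have h3 : ∑ g ∈ Finset.Icc 1 D, (g : ℝ)⁻¹ ≤ 1 + Real.log D := by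
    have := harmonic_le_one_add_log D
    rw [harmonic_eq_sum_Icc] at this
    push_cast at this
    exact this
  calc _ ≤ 16 * (q.divisors.card : ℝ) ^ 2 * ((K : ℝ) ^ 2 * (D : ℝ) ^ 2 / q + K * √K * D) *
        (1 + Real.log D) := by gcongr
    _ = _ := by ring

theorem sum_sq_norm_fourier {q : ℕ} [NeZero q] (f : ZMod q → ℂ) :
    ∑ h : ZMod q, ‖∑ a : ZMod q, f a * ZMod.stdAddChar (a * h)‖ ^ 2 =
      q * ∑ a : ZMod q, ‖f a‖ ^ 2 := by
  have key : ∀ h : ZMod q, ((‖∑ a : ZMod q, f a * ZMod.stdAddChar (a * h)‖ ^ 2 : ℝ) : ℂ) =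
      ∑ a : ZMod q, ∑ b : ZMod q, f a * (starRingEnd ℂ) (f b) *
        ZMod.stdAddChar (h * (a - b)) := by
    intro h
    push_cast
    rw [← Complex.mul_conj', map_sum, Finset.sum_mul_sum]
    refine Finset.sum_congr rfl fun a _ => Finset.sum_congr rfl fun b _ => ?_
    rw [map_mul (starRingEnd ℂ), ← AddChar.map_neg_eq_conj, mul_mul_mul_comm,
      ← AddChar.map_add_eq_mul]
    congr 2
    ring
  have hC : ((∑ h : ZMod q, ‖∑ a : ZMod q, f a * ZMod.stdAddChar (a * h)‖ ^ 2 : ℝ) : ℂ) =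
      ((q * ∑ a : ZMod q, ‖f a‖ ^ 2 : ℝ) : ℂ) := by
    rw [Complex.ofReal_sum]
    simp_rw [key]
    rw [Finset.sum_comm]
    push_cast
    rw [Finset.mul_sum]
    refine Finset.sum_congr rfl fun a _ => ?_
    rw [Finset.sum_comm]
    simp_rw [← Finset.mul_sum]
    have horth : ∀ b : ZMod q, ∑ h : ZMod q, (ZMod.stdAddChar (h * (a - b)) : ℂ) =
        if b = a then (q : ℂ) else 0 := by
      intro b
      rw [AddChar.sum_mulShift _ (ZMod.isPrimitive_stdAddChar q), ZMod.card]
      simp only [sub_eq_zero, eq_comm]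
      split_ifs <;> simp
    simp_rw [horth]
    simp only [mul_ite, mul_zero, Finset.sum_ite_eq', Finset.mem_univ, if_true]
    rw [← Complex.mul_conj']
    ring
  exact_mod_cast hC

theorem norm_sum_stdAddChar_le {q : ℕ} [NeZero q] (M : ℕ) {k : ZMod q} (hk : k ≠ 0) :
    ‖∑ m ∈ Finset.Icc 1 M, (ZMod.stdAddChar ((m : ZMod q) * k) : ℂ)‖ ≤
      min (M : ℝ) (q / |(k.valMinAbs : ℝ)|) := by
  have hn : ∀ y : ZMod q, ‖(ZMod.stdAddChar y : ℂ)‖ = 1 := fun y => AddChar.norm_apply _ _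
  refine le_min ((norm_sum_le _ _).trans (by simp [hn])) ?_
  set z : ℂ := ZMod.stdAddChar k with hz
  have hpow : ∀ m : ℕ, (ZMod.stdAddChar ((m : ZMod q) * k) : ℂ) = z ^ m := fun m => by
    rw [hz, ← nsmul_eq_mul, AddChar.map_nsmul_eq_pow]
  have hq : (0 : ℝ) < q := by exact_mod_cast Nat.pos_of_neZero q
  have hv0 : k.valMinAbs ≠ 0 := fun h => hk ((ZMod.valMinAbs_eq_zero k).1 h)
  have habs : 0 < |(k.valMinAbs : ℝ)| := abs_pos.2 (by exact_mod_cast hv0)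
  have hle : 2 * |(k.valMinAbs : ℝ)| ≤ q := by
    have h1 := ZMod.natAbs_valMinAbs_le k
    have h2 : 2 * k.valMinAbs.natAbs ≤ q := by omega
    have h3 : ((k.valMinAbs.natAbs : ℕ) : ℝ) = |(k.valMinAbs : ℝ)| := by
      rw [Nat.cast_natAbs, Int.cast_abs]
    rw [← h3]; exact_mod_cast h2
  have hz1 : 4 * |(k.valMinAbs : ℝ)| / q ≤ ‖z - 1‖ := by
    have e : z = Complex.exp (Complex.I * ((2 * Real.pi * k.valMinAbs / q : ℝ) : ℂ)) := by
      rw [hz, ← ZMod.coe_valMinAbs k, ZMod.stdAddChar_coe, ZMod.coe_valMinAbs]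
      congr 1; push_cast; ring
    rw [e, Complex.norm_exp_I_mul_ofReal_sub_one, norm_mul, Real.norm_ofNat, Real.norm_eq_abs]
    have h1 : 2 * Real.pi * (k.valMinAbs : ℝ) / q / 2 = Real.pi * k.valMinAbs / q := by ring
    rw [h1]
    have h2 : |Real.sin (Real.pi * k.valMinAbs / q)| =
        |Real.sin (Real.pi * |(k.valMinAbs : ℝ)| / q)| := by
      rcases abs_choice (k.valMinAbs : ℝ) with h | h
      · rw [h]
      · rw [h, mul_neg, neg_div, Real.sin_neg, abs_neg]
    rw [h2]
    have h3 := Real.mul_le_sin (x := Real.pi * |(k.valMinAbs : ℝ)| / q) (by positivity) (by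
      rw [div_le_iff₀ hq]
      nlinarith [Real.pi_pos])
    have h4 : 2 / Real.pi * (Real.pi * |(k.valMinAbs : ℝ)| / q) =
        2 * |(k.valMinAbs : ℝ)| / q := by
      have := Real.pi_ne_zero
      field_simp
    rw [h4] at h3
    have h5 := h3.trans (le_abs_self _)
    calc 4 * |(k.valMinAbs : ℝ)| / q = 2 * (2 * |(k.valMinAbs : ℝ)| / q) := by ring
      _ ≤ _ := by gcongr
  have hz0 : 0 < ‖z - 1‖ := lt_of_lt_of_le (by positivity) hz1
  have hsum : (∑ m ∈ Finset.Icc 1 M, (ZMod.stdAddChar ((m : ZMod q) * k) : ℂ)) * (z - 1) =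
      z * (z ^ M - 1) := by
    simp_rw [hpow]
    have : Finset.Icc 1 M = Finset.Ico 1 (M + 1) := by ext; simp
    rw [this, geom_sum_Ico_mul z (by omega)]
    ring
  have h2 : ‖z * (z ^ M - 1)‖ ≤ 2 := by
    rw [norm_mul, hn, one_mul]
    refine (norm_sub_le _ _).trans ?_
    rw [norm_pow, hn, one_pow, norm_one]; norm_num
  rw [← hsum, norm_mul] at h2
  rw [le_div_iff₀ habs]
  have h3 : ‖∑ m ∈ Finset.Icc 1 M, (ZMod.stdAddChar ((m : ZMod q) * k) : ℂ)‖ *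
      (4 * |(k.valMinAbs : ℝ)| / q) ≤ 2 := (by gcongr : _ ≤ _).trans h2
  rw [mul_div_assoc', div_le_iff₀ hq] at h3
  linarith [mul_nonneg (norm_nonneg (∑ m ∈ Finset.Icc 1 M,
    (ZMod.stdAddChar ((m : ZMod q) * k) : ℂ))) habs.le]

/-- The number of `1 ≤ m ≤ M` with `m d² ≡ a (mod q)`. -/
noncomputable def sqMulCount (q M d : ℕ) (a : ZMod q) : ℕ :=
  ((Finset.Icc 1 M).filter fun m : ℕ => ((m * d ^ 2 : ℕ) : ZMod q) = a).card

theorem sum_sqMulCount_mul_stdAddChar {q : ℕ} [NeZero q] (M d : ℕ) (h : ZMod q) :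
    ∑ a : ZMod q, (sqMulCount q M d a : ℂ) * ZMod.stdAddChar (a * h) =
      ∑ m ∈ Finset.Icc 1 M, (ZMod.stdAddChar ((m : ZMod q) * (h * (d : ZMod q) ^ 2)) : ℂ) := by
  rw [← Finset.sum_fiberwise_of_maps_to (s := Finset.Icc 1 M) (t := Finset.univ)
    (g := fun m : ℕ => ((m * d ^ 2 : ℕ) : ZMod q)) (fun _ _ => Finset.mem_univ _)]
  refine Finset.sum_congr rfl fun a _ => ?_
  rw [sqMulCount, ← nsmul_eq_mul, ← Finset.sum_const]
  refine Finset.sum_congr rfl fun m hm => ?_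
  rw [← (Finset.mem_filter.1 hm).2]
  congr 1
  push_cast
  ring

theorem sum_sq_sqMulCount_sub_mean_le {q : ℕ} [NeZero q] (S : Finset ℕ) (M : ℕ → ℕ) (c : ℕ → ℝ)
    (hc : ∀ d, |c d| ≤ 1) (hS : ∀ d ∈ S, d.Coprime q) :
    ∑ a : ZMod q, (∑ d ∈ S, c d * ((sqMulCount q (M d) d a : ℝ) - M d / q)) ^ 2 ≤
      (1 / q) * ∑ h ∈ Finset.univ.erase (0 : ZMod q),
        (∑ d ∈ S, min (M d : ℝ)
          (q / |((h * (d : ZMod q) ^ 2).valMinAbs : ℝ)|)) ^ 2 := by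
  have hq : (0 : ℝ) < q := by exact_mod_cast Nat.pos_of_neZero q
  have hqC : (q : ℂ) ≠ 0 := by exact_mod_cast hq.ne'
  set g : ZMod q → ℂ :=
    fun a => ∑ d ∈ S, (c d : ℂ) * ((sqMulCount q (M d) d a : ℂ) - M d / q) with hg
  have hgn : ∀ a, ‖g a‖ ^ 2 =
      (∑ d ∈ S, c d * ((sqMulCount q (M d) d a : ℝ) - M d / q)) ^ 2 := by
    intro a
    rw [← sq_abs (∑ d ∈ S, c d * ((sqMulCount q (M d) d a : ℝ) - M d / q)),
      ← Real.norm_eq_abs, ← Complex.norm_real]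
    congr 2
    simp only [hg]
    push_cast
    rfl
  have hpars := sum_sq_norm_fourier g
  simp_rw [hgn] at hpars
  have hhat : ∀ h : ZMod q, ∑ a : ZMod q, g a * ZMod.stdAddChar (a * h) =
      ∑ d ∈ S, (c d : ℂ) * (∑ m ∈ Finset.Icc 1 (M d),
        (ZMod.stdAddChar ((m : ZMod q) * (h * (d : ZMod q) ^ 2)) : ℂ) -
          M d / q * (if h = 0 then (q : ℂ) else 0)) := by
    intro h
    simp only [hg, Finset.sum_mul]
    rw [Finset.sum_comm]
    refine Finset.sum_congr rfl fun d _ => ?_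
    simp_rw [mul_assoc]
    rw [← Finset.mul_sum]
    congr 1
    simp_rw [sub_mul]
    rw [Finset.sum_sub_distrib, sum_sqMulCount_mul_stdAddChar, ← Finset.mul_sum,
      AddChar.sum_mulShift _ (ZMod.isPrimitive_stdAddChar q), ZMod.card]
    split_ifs <;> simp
  rw [one_div, inv_mul_eq_div, le_div_iff₀ hq, mul_comm _ (q : ℝ), ← hpars,
    ← Finset.add_sum_erase _ _ (Finset.mem_univ (0 : ZMod q))]
  have h0 : ∑ a : ZMod q, g a * ZMod.stdAddChar (a * 0) = 0 := by
    rw [hhat]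
    refine Finset.sum_eq_zero fun d _ => ?_
    simp [hqC]
  rw [h0, norm_zero, zero_pow two_ne_zero, zero_add]
  refine Finset.sum_le_sum fun h hh => pow_le_pow_left₀ (norm_nonneg _) ?_ 2
  have hne : h ≠ 0 := Finset.ne_of_mem_erase hh
  rw [hhat]
  refine (norm_sum_le _ _).trans (Finset.sum_le_sum fun d hd => ?_)
  rw [if_neg hne, mul_zero, sub_zero, norm_mul, Complex.norm_real, Real.norm_eq_abs]
  have hu : IsUnit ((d : ZMod q) ^ 2) := ((ZMod.isUnit_iff_coprime d q).2 (hS d hd)).pow 2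
  have hk : h * (d : ZMod q) ^ 2 ≠ 0 := fun h' => hne ((hu.mul_left_eq_zero).1 h')
  refine (mul_le_of_le_one_left (norm_nonneg _) (hc d)).trans ?_
  exact norm_sum_stdAddChar_le (M d) hk

/-- The divisor bound. -/
theorem exists_card_divisors_le (δ : ℝ) (hδ : 0 < δ) :
    ∃ C : ℝ, 0 < C ∧ ∀ n : ℕ, n ≠ 0 → (n.divisors.card : ℝ) ≤ C * (n : ℝ) ^ δ := by
  set A : ℝ := 1 + 1 / (δ * Real.log 2) with hA
  have hl2 : 0 < Real.log 2 := Real.log_pos one_lt_two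
  have hA1 : 1 ≤ A := by rw [hA]; linarith [show 0 < 1 / (δ * Real.log 2) by positivity]
  obtain ⟨P, hP⟩ := exists_nat_ge ((2 : ℝ) ^ (1 / δ))
  have hlocal : ∀ p v : ℕ, p.Prime →
      ((v : ℝ) + 1) ≤ (if p < P then A else 1) * ((p : ℝ) ^ v) ^ δ := by
    intro p v hp
    have hp2 : (2 : ℝ) ≤ p := by exact_mod_cast hp.two_le
    have hv : (0 : ℝ) ≤ v := Nat.cast_nonneg v
    have hrw : ((p : ℝ) ^ v) ^ δ = ((p : ℝ) ^ δ) ^ v := by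
      rw [← Real.rpow_natCast_mul (by positivity), mul_comm, Real.rpow_mul_natCast (by positivity)]
    split_ifs with h
    · have h1 : 1 + v * (δ * Real.log 2) ≤ ((p : ℝ) ^ v) ^ δ := by
        rw [hrw]
        calc 1 + v * (δ * Real.log 2) ≤ Real.exp (v * (δ * Real.log 2)) := by
              linarith [Real.add_one_le_exp (v * (δ * Real.log 2))]
          _ = ((2 : ℝ) ^ δ) ^ v := by
              rw [Real.rpow_def_of_pos two_pos, ← Real.exp_nat_mul]; ring_nf
          _ ≤ _ := by gcongr
      calc (v : ℝ) + 1 ≤ A * (1 + v * (δ * Real.log 2)) := by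
            have : A * (1 + v * (δ * Real.log 2)) =
                1 + v + v * (δ * Real.log 2) + 1 / (δ * Real.log 2) := by
              rw [hA]; field_simp; ring
            rw [this]
            have : 0 ≤ v * (δ * Real.log 2) := by positivity
            have : 0 ≤ 1 / (δ * Real.log 2) := by positivity
            linarith
        _ ≤ _ := by gcongr
    · rw [one_mul, hrw]
      have h1 : (2 : ℝ) ≤ (p : ℝ) ^ δ := by
        have h2 : (2 : ℝ) ^ (1 / δ) ≤ p := hP.trans (by exact_mod_cast not_lt.1 h)
        calc (2 : ℝ) = ((2 : ℝ) ^ (1 / δ)) ^ δ := by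
              rw [← Real.rpow_mul two_pos.le, one_div_mul_cancel hδ.ne', Real.rpow_one]
          _ ≤ _ := by gcongr
      calc (v : ℝ) + 1 ≤ 2 ^ v := by exact_mod_cast Nat.lt_two_pow_self
        _ ≤ _ := by gcongr
  refine ⟨A ^ P, by positivity, fun n hn => ?_⟩
  rw [Nat.card_divisors hn]
  push_cast
  calc ∏ p ∈ n.primeFactors, ((n.factorization p : ℝ) + 1)
      ≤ ∏ p ∈ n.primeFactors, (if p < P then A else 1) * ((p : ℝ) ^ n.factorization p) ^ δ :=
        Finset.prod_le_prod (fun _ _ => by positivity) fun p hp =>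
          hlocal p _ (Nat.prime_of_mem_primeFactors hp)
    _ = (∏ p ∈ n.primeFactors, (if p < P then A else 1)) * (n : ℝ) ^ δ := by
        rw [Finset.prod_mul_distrib, Real.finsetProd_rpow _ _ (fun _ _ => by positivity)]
        congr 2
        exact_mod_cast Nat.prod_factorization_pow_eq_self hn
    _ ≤ A ^ P * (n : ℝ) ^ δ := by
        gcongr
        rw [Finset.prod_ite, Finset.prod_const, Finset.prod_const_one, mul_one]
        refine pow_le_pow_right₀ hA1 ?_
        calc _ ≤ (Finset.range P).card := Finset.card_le_card fun p hp => by
              simpa using (Finset.mem_filter.1 hp).2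
          _ = P := Finset.card_range P

theorem one_add_log_le_rpow {δ x : ℝ} (hδ : 0 < δ) (hx : 1 ≤ x) :
    1 + Real.log x ≤ (1 + 1 / δ) * x ^ δ := by
  have h1 := Real.log_le_rpow_div (zero_le_one.trans hx) hδ
  have h2 := Real.one_le_rpow hx hδ.le
  calc 1 + Real.log x ≤ x ^ δ + x ^ δ / δ := by linarith
    _ = _ := by ring

theorem abs_moebius_eq_sum {n N : ℕ} (hn : 0 < n) (hnN : n ≤ N) :
    |((ArithmeticFunction.moebius n : ℤ) : ℝ)| =
      ∑ d ∈ (Finset.Icc 1 N).filter (fun d => d ^ 2 ∣ n),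
        ((ArithmeticFunction.moebius d : ℤ) : ℝ) := by
  obtain ⟨a, b, ha, hb, hab, hsq⟩ := Nat.sq_mul_squarefree_of_pos hn
  have hfil : (Finset.Icc 1 N).filter (fun d => d ^ 2 ∣ n) = b.divisors := by
    ext d
    rw [Finset.mem_filter, Finset.mem_Icc, Nat.mem_divisors]
    constructor
    · rintro ⟨⟨h1, -⟩, h2⟩
      refine ⟨?_, hb.ne'⟩
      rw [← hab] at h2
      obtain ⟨g, d', b', hg, hco, hd', hb'⟩ := Nat.exists_coprime' (Nat.gcd_pos_of_pos_right d hb)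
      have h3 : d' ^ 2 ∣ b' ^ 2 * a := by
        refine Nat.dvd_of_mul_dvd_mul_left (pow_pos hg 2) ?_
        have e1 : d ^ 2 = g ^ 2 * d' ^ 2 := by rw [hd']; ring
        have e2 : b ^ 2 * a = g ^ 2 * (b' ^ 2 * a) := by rw [hb']; ring
        rwa [e1, e2] at h2
      have h4 : d' * d' ∣ a := by
        rw [← sq]; exact (Nat.Coprime.pow 2 2 hco).dvd_of_dvd_mul_left h3
      have h5 : d' = 1 := Nat.isUnit_iff.1 (hsq d' h4)
      rw [hd', h5, one_mul, hb']
      exact Dvd.intro_left _ rfl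
    · rintro ⟨h1, -⟩
      have hd := Nat.pos_of_dvd_of_pos h1 hb
      refine ⟨⟨hd, ?_⟩, (pow_dvd_pow_of_dvd h1 2).trans (hab ▸ Dvd.intro _ rfl)⟩
      refine (Nat.le_of_dvd hb h1).trans (le_trans ?_ hnN)
      rw [← hab]; nlinarith
  rw [hfil, ← Int.cast_sum, ← ArithmeticFunction.coe_mul_zeta_apply,
    ArithmeticFunction.moebius_mul_coe_zeta, ArithmeticFunction.one_apply]
  split_ifs with h
  · rw [h, one_pow, one_mul] at hab
    rw [← hab, ← Int.cast_abs, ArithmeticFunction.abs_moebius_eq_one_of_squarefree hsq]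
  · rw [ArithmeticFunction.moebius_eq_zero_of_not_squarefree]
    · simp
    · intro hs
      exact h (Nat.isUnit_iff.1 (hs b (hab ▸ by rw [sq]; exact Dvd.intro _ rfl)))

theorem log_two_add_one_le {X : ℕ} {x : ℝ} (hx : 1 ≤ x) (hX : X ≤ ⌊x⌋₊) :
    ((Nat.log 2 X + 1 : ℕ) : ℝ) ≤ 2 * (1 + Real.log x) := by
  have hlog : 0 ≤ Real.log x := Real.log_nonneg hx
  rcases Nat.eq_zero_or_pos X with rfl | hX0
  · simp; linarith
  have h1 : ((2 : ℝ)) ^ (Nat.log 2 X) ≤ x := by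
    have : ((2 ^ Nat.log 2 X : ℕ) : ℝ) ≤ X := by exact_mod_cast Nat.pow_log_le_self 2 hX0.ne'
    push_cast at this
    exact this.trans ((by exact_mod_cast hX : (X : ℝ) ≤ ⌊x⌋₊).trans
      (Nat.floor_le (zero_le_one.trans hx)))
  have h2 := Real.log_le_log (by positivity) h1
  rw [Real.log_pow] at h2
  have h3 := Real.log_two_gt_d9
  have h4 : (Nat.log 2 X : ℝ) * (1 / 2) ≤ Nat.log 2 X * Real.log 2 := by gcongr; linarith
  push_cast
  linarith

theorem one_add_log_dyadic_le {x : ℝ} {b : ℕ} (hb : 0 < b) (hbx : (b : ℝ) ≤ x) (hx : 1 ≤ x) :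
    1 + Real.log ((2 * b : ℕ) : ℝ) ≤ 2 * (1 + Real.log x) := by
  have hb' : (0 : ℝ) < b := by exact_mod_cast hb
  push_cast
  rw [Real.log_mul two_ne_zero hb'.ne']
  have := Real.log_le_log hb' hbx
  have := Real.log_two_lt_d9
  have := Real.log_nonneg hx
  linarith

theorem sum_sq_card_filter_valMinAbs_le {q : ℕ} [NeZero q] (S : Finset ℕ) (i j : ℕ)
    (hS : ∀ d ∈ S, 1 ≤ d ∧ d.Coprime q) :
    ∑ h ∈ Finset.univ.erase (0 : ZMod q), ((S.filter fun d : ℕ =>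
      (Nat.log 2 (h * (d : ZMod q) ^ 2).valMinAbs.natAbs, Nat.log 2 d) = (i, j)).card) ^ 2 ≤
      (sqCongrQuads q (2 * 2 ^ i) (2 * 2 ^ j)).card := by
  set R : ZMod q → Finset ℕ := fun h => S.filter fun d : ℕ =>
      (Nat.log 2 (h * (d : ZMod q) ^ 2).valMinAbs.natAbs, Nat.log 2 d) = (i, j) with hR
  have e : ∑ h ∈ Finset.univ.erase (0 : ZMod q), (R h).card ^ 2 =
      ((Finset.univ.erase (0 : ZMod q)).sigma fun h => R h ×ˢ R h).card := by
    rw [Finset.card_sigma]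
    exact Finset.sum_congr rfl fun h _ => by rw [Finset.card_product, sq]
  have hunit : ∀ d ∈ S, IsUnit ((d : ZMod q) ^ 2) := fun d hd =>
    ((ZMod.isUnit_iff_coprime d q).2 (hS d hd).2).pow 2
  rw [e]
  refine Finset.card_le_card_of_injOn (fun p => (((p.1 * (p.2.1 : ZMod q) ^ 2).valMinAbs,
    (p.1 * (p.2.2 : ZMod q) ^ 2).valMinAbs), p.2)) ?_ ?_
  · rintro ⟨h, d₁, d₂⟩ hp
    simp only [Finset.mem_coe, Finset.mem_sigma, Finset.mem_product, hR, Finset.mem_filter,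
      Finset.mem_erase, Prod.mk.injEq] at hp
    obtain ⟨⟨hh, -⟩, ⟨h1, h2, h3⟩, h4, h5, h6⟩ := hp
    have hne : ∀ d ∈ S, (h * (d : ZMod q) ^ 2).valMinAbs ≠ 0 := fun d hd h' =>
      hh (((hunit d hd).mul_left_eq_zero).1 ((ZMod.valMinAbs_eq_zero _).1 h'))
    have hlt : ∀ n : ℕ, ∀ k, Nat.log 2 n = k → n < 2 * 2 ^ k := fun n k hk => by
      rw [← pow_succ', ← hk]; exact Nat.lt_pow_succ_log_self one_lt_two n
    have habs : ∀ z : ℤ, Nat.log 2 z.natAbs = i →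
        -((2 * 2 ^ i : ℕ) : ℤ) ≤ z ∧ z ≤ ((2 * 2 ^ i : ℕ) : ℤ) := fun z hz => by
      have := hlt _ _ hz
      omega
    simp only [Finset.mem_coe, mem_sqCongrQuads]
    refine ⟨⟨habs _ h2, habs _ h5⟩, ⟨⟨(hS _ h1).1, (hlt _ _ h3).le⟩, (hS _ h4).1,
      (hlt _ _ h6).le⟩, hne _ h1, hne _ h4, (hS _ h1).2, (hS _ h4).2, ?_⟩
    rw [← ZMod.intCast_zmod_eq_zero_iff_dvd]
    push_cast
    ring
  · rintro ⟨h, d₁, d₂⟩ hp ⟨h', d₁', d₂'⟩ hp' heq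
    simp only [Finset.mem_coe, Finset.mem_sigma, Finset.mem_product, hR, Finset.mem_filter] at hp
    simp only [Prod.mk.injEq] at heq
    obtain ⟨⟨e1, -⟩, rfl, rfl⟩ := heq
    have := (hunit d₁ hp.2.1.1).mul_left_injective (ZMod.injective_valMinAbs e1)
    subst this
    rfl

/-- The contribution of the nonzero frequencies for small `d`. -/
theorem sum_sq_min_le {q : ℕ} [NeZero q] {x : ℝ} (hqx : (q : ℝ) ≤ x) (S : Finset ℕ)
    (hS : ∀ d ∈ S, 1 ≤ d ∧ d.Coprime q ∧ (d : ℝ) ^ 2 * √q ≤ x) :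
    ∑ h ∈ Finset.univ.erase (0 : ZMod q), (∑ d ∈ S, min ((⌊x / (d : ℝ) ^ 2⌋₊ : ℕ) : ℝ)
      (q / |((h * (d : ZMod q) ^ 2).valMinAbs : ℝ)|)) ^ 2 ≤
      8192 * (1 + Real.log x) ^ 5 * (q.divisors.card : ℝ) ^ 2 *
        (q * (x / √q + √q * √x)) := by
  have hq0 : 0 < q := Nat.pos_of_neZero q
  have hq1 : (1 : ℝ) ≤ q := by exact_mod_cast hq0
  have hq : (0 : ℝ) < q := by linarith
  have hx : 1 ≤ x := hq1.trans hqx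
  have hx0 : 0 < x := by linarith
  have hsq : 1 ≤ √(q : ℝ) := Real.one_le_sqrt.2 hq1
  have hℓ : 1 ≤ 1 + Real.log x := by linarith [Real.log_nonneg hx]
  obtain ⟨ℓ, hℓd⟩ : ∃ ℓ, ℓ = 1 + Real.log x := ⟨_, rfl⟩
  obtain ⟨τ, hτ⟩ : ∃ τ : ℝ, τ = (q.divisors.card : ℝ) := ⟨_, rfl⟩
  set X := ⌊x⌋₊ with hX
  set Λ := Nat.log 2 X + 1 with hΛ
  set w : ℕ × ℕ → ℝ := fun p => min (x / ((2 : ℝ) ^ p.2) ^ 2) (q / 2 ^ p.1) with hw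
  have hw0 : ∀ p, 0 ≤ w p := fun p => le_min (by positivity) (by positivity)
  set idx : ZMod q → ℕ → ℕ × ℕ := fun h d =>
    (Nat.log 2 (h * (d : ZMod q) ^ 2).valMinAbs.natAbs, Nat.log 2 d) with hidx
  set r : ZMod q → ℕ × ℕ → ℕ := fun h p => (S.filter fun d => idx h d = p).card with hr
  set J := Finset.range Λ ×ˢ Finset.range Λ with hJ
  have hqX : q ≤ X := Nat.le_floor hqx
  have hdX : ∀ d ∈ S, d ≤ X := fun d hd => Nat.le_floor (by
    obtain ⟨h1, -, h2⟩ := hS d hd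
    have h1' : (1 : ℝ) ≤ d := by exact_mod_cast h1
    calc (d : ℝ) ≤ (d : ℝ) ^ 2 * 1 := by nlinarith
      _ ≤ (d : ℝ) ^ 2 * √q := by gcongr
      _ ≤ x := h2)
  have hkq : ∀ k : ZMod q, 2 * k.valMinAbs.natAbs ≤ q := fun k => by
    have := ZMod.natAbs_valMinAbs_le k
    omega
  have hmap : ∀ h, ∀ d ∈ S, idx h d ∈ J := fun h d hd => by
    simp only [hJ, hidx, Finset.mem_product, Finset.mem_range, hΛ]
    refine ⟨Nat.lt_succ_of_le (Nat.log_mono_right ?_),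
      Nat.lt_succ_of_le (Nat.log_mono_right (hdX d hd))⟩
    have := hkq (h * (d : ZMod q) ^ 2)
    omega
  have hnz : ∀ h ∈ Finset.univ.erase (0 : ZMod q), ∀ d ∈ S,
      (h * (d : ZMod q) ^ 2).valMinAbs.natAbs ≠ 0 := fun h hh d hd h' => by
    have hu : IsUnit ((d : ZMod q) ^ 2) :=
      ((ZMod.isUnit_iff_coprime d q).2 (hS d hd).2.1).pow 2
    exact Finset.ne_of_mem_erase hh ((hu.mul_left_eq_zero).1
      ((ZMod.valMinAbs_eq_zero _).1 (Int.natAbs_eq_zero.1 h')))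
  have hterm : ∀ h ∈ Finset.univ.erase (0 : ZMod q),
      (∑ d ∈ S, min ((⌊x / (d : ℝ) ^ 2⌋₊ : ℕ) : ℝ)
        (q / |((h * (d : ZMod q) ^ 2).valMinAbs : ℝ)|)) ^ 2 ≤
      (J.card : ℝ) * ∑ p ∈ J, w p ^ 2 * (r h p : ℝ) ^ 2 := by
    intro h hh
    have h1 : ∑ d ∈ S, min ((⌊x / (d : ℝ) ^ 2⌋₊ : ℕ) : ℝ)
        (q / |((h * (d : ZMod q) ^ 2).valMinAbs : ℝ)|) ≤ ∑ p ∈ J, w p * r h p := by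
      rw [← Finset.sum_fiberwise_of_maps_to (hmap h)]
      refine Finset.sum_le_sum fun p _ => ?_
      rw [mul_comm, ← nsmul_eq_mul]
      refine Finset.sum_le_card_nsmul _ _ _ fun d hd => ?_
      rw [Finset.mem_filter] at hd
      obtain ⟨hd, hp⟩ := hd
      rw [← hp]
      have hd0 : d ≠ 0 := by have := (hS d hd).1; omega
      refine min_le_min ((Nat.floor_le (by positivity)).trans ?_) ?_
      · have : ((2 : ℝ) ^ Nat.log 2 d) ≤ d := by
          exact_mod_cast Nat.pow_log_le_self 2 hd0
        simp only [hidx]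
        gcongr
      · have : ((2 : ℝ) ^ Nat.log 2 (h * (d : ZMod q) ^ 2).valMinAbs.natAbs) ≤
            |((h * (d : ZMod q) ^ 2).valMinAbs : ℝ)| := by
          rw [← Int.cast_abs, ← Nat.cast_natAbs]
          exact_mod_cast Nat.pow_log_le_self 2 (hnz h hh d hd)
        simp only [hidx]
        gcongr
    calc _ ≤ (∑ p ∈ J, w p * r h p) ^ 2 :=
          pow_le_pow_left₀ (Finset.sum_nonneg fun d _ => le_min (by positivity)
            (by positivity)) h1 2
      _ ≤ J.card * ∑ p ∈ J, (w p * r h p) ^ 2 := sq_sum_le_card_mul_sum_sq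
      _ = _ := by simp_rw [mul_pow]
  have hbox : ∀ p ∈ J, w p ^ 2 * ∑ h ∈ Finset.univ.erase (0 : ZMod q), (r h p : ℝ) ^ 2 ≤
      512 * ℓ * τ ^ 2 * (q * (x / √q + √q * √x)) := by
    rintro ⟨i, j⟩ -
    by_cases hex : ∃ h ∈ Finset.univ.erase (0 : ZMod q), ∃ d ∈ S, idx h d = (i, j)
    swap
    · rw [Finset.sum_eq_zero, mul_zero]
      · rw [hℓd]; positivity
      · intro h hh
        simp only [hr]
        rw [Finset.filter_eq_empty_iff.2 fun d hd hp => hex ⟨h, hh, d, hd, hp⟩]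
        simp
    obtain ⟨h, hh, d, hd, hp⟩ := hex
    simp only [hidx, Prod.mk.injEq] at hp
    obtain ⟨hp1, hp2⟩ := hp
    have hd0 : d ≠ 0 := by have := (hS d hd).1; omega
    have ha := Nat.pow_log_le_self 2 (hnz h hh d hd)
    have hb := Nat.pow_log_le_self 2 hd0
    rw [hp1] at ha
    rw [hp2] at hb
    have hKq : 2 * 2 ^ i ≤ q := (Nat.mul_le_mul_left 2 ha).trans (hkq _)
    have hbR : ((2 : ℝ) ^ j) ≤ d := by exact_mod_cast hb
    have hcard : ∑ h ∈ Finset.univ.erase (0 : ZMod q), r h (i, j) ^ 2 ≤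
        (sqCongrQuads q (2 * 2 ^ i) (2 * 2 ^ j)).card :=
      sum_sq_card_filter_valMinAbs_le S i j fun d hd => ⟨(hS d hd).1, (hS d hd).2.1⟩
    have hcount : ∑ h ∈ Finset.univ.erase (0 : ZMod q), (r h (i, j) : ℝ) ^ 2 ≤
        ((sqCongrQuads q (2 * 2 ^ i) (2 * 2 ^ j)).card : ℝ) := by
      exact_mod_cast hcard
    have hN := card_sqCongrQuads_le (D := 2 * 2 ^ j) hq0 hKq
    have hlog : 1 + Real.log ((2 * 2 ^ j : ℕ) : ℝ) ≤ 2 * ℓ := by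
      rw [hℓd]
      refine one_add_log_dyadic_le (by positivity) ?_ hx
      push_cast
      exact hbR.trans ((by exact_mod_cast hdX d hd : (d : ℝ) ≤ X).trans (Nat.floor_le hx0.le))
    have hb2 : ((2 : ℝ) ^ j) ^ 2 ≤ x / √q := by
      rw [le_div_iff₀ (by positivity)]
      refine le_trans ?_ (hS d hd).2.2
      gcongr
    obtain ⟨W, hW⟩ : ∃ W, W = w (i, j) := ⟨_, rfl⟩
    have hW0 : 0 ≤ W := hW ▸ hw0 _
    have hW1 : W ≤ x / ((2 : ℝ) ^ j) ^ 2 := hW ▸ min_le_left _ _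
    have hW2 : W ≤ q / (2 : ℝ) ^ i := hW ▸ min_le_right _ _
    rw [← hW]
    push_cast at hN hlog
    have hapos : (0 : ℝ) < 2 ^ i := by positivity
    have hbpos : (0 : ℝ) < 2 ^ j := by positivity
    generalize (2 : ℝ) ^ i = a at *
    generalize (2 : ℝ) ^ j = b at *
    rw [le_div_iff₀ (by positivity)] at hW1 hW2
    have hmain : W ^ 2 * ((2 * a) ^ 2 * (2 * b) ^ 2 / q + 2 * a * √(2 * a) * (2 * b)) ≤
        16 * (q * (x / √q + √q * √x)) := by
      have t1 : W ^ 2 * ((2 * a) ^ 2 * (2 * b) ^ 2 / q) ≤ 16 * (q * (x / √q)) := by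
        calc W ^ 2 * ((2 * a) ^ 2 * (2 * b) ^ 2 / q) = 16 * ((W * a) ^ 2 * b ^ 2 / q) := by ring
          _ ≤ 16 * ((q : ℝ) ^ 2 * (x / √q) / q) := by gcongr
          _ = _ := by field_simp
      have t2 : W ^ 2 * (2 * a * √(2 * a) * (2 * b)) ≤ 16 * (q * (√q * √x)) := by
        have s1 : √(2 * a) ≤ 2 * √a := by
          rw [Real.sqrt_mul two_pos.le]
          gcongr
          exact Real.sqrt_le_sqrt (by norm_num : (2 : ℝ) ≤ 2 ^ 2) |>.trans (by simp)
        have s2 : √(W * a) ≤ √q := Real.sqrt_le_sqrt hW2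
        have s3 : √(W * b ^ 2) ≤ √x := Real.sqrt_le_sqrt hW1
        rw [Real.sqrt_mul hW0] at s2 s3
        rw [Real.sqrt_sq hbpos.le] at s3
        calc W ^ 2 * (2 * a * √(2 * a) * (2 * b)) ≤ W ^ 2 * (2 * a * (2 * √a) * (2 * b)) := by
              gcongr
          _ = 8 * ((W * a) * (W * √a * b)) := by ring
          _ = 8 * ((W * a) * ((√W * √a) * (√W * b))) := by
              nth_rewrite 2 [← Real.mul_self_sqrt hW0]; ring
          _ ≤ 8 * (q * (√q * √x)) := by gcongr
          _ ≤ 16 * (q * (√q * √x)) := by gcongr; norm_num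
      linarith
    calc W ^ 2 * ∑ h ∈ Finset.univ.erase (0 : ZMod q), (r h (i, j) : ℝ) ^ 2
        ≤ W ^ 2 * (16 * τ ^ 2 * (2 * ℓ) *
          ((2 * a) ^ 2 * (2 * b) ^ 2 / q + 2 * a * √(2 * a) * (2 * b))) := by
          refine mul_le_mul_of_nonneg_left (hcount.trans (hN.trans ?_)) (sq_nonneg _)
          rw [← hτ]
          gcongr
      _ = 32 * ℓ * τ ^ 2 * (W ^ 2 * ((2 * a) ^ 2 * (2 * b) ^ 2 / q +
          2 * a * √(2 * a) * (2 * b))) := by ring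
      _ ≤ 32 * ℓ * τ ^ 2 * (16 * (q * (x / √q + √q * √x))) := by
          have : 0 ≤ ℓ := by rw [hℓd]; linarith
          gcongr
      _ = _ := by ring
  have hΛ2 : (Λ : ℝ) ≤ 2 * ℓ := hℓd ▸ log_two_add_one_le hx le_rfl
  rw [← hℓd, ← hτ]
  have hℓ0 : 0 ≤ ℓ := by rw [hℓd]; linarith
  calc _ ≤ ∑ h ∈ Finset.univ.erase (0 : ZMod q),
        (J.card : ℝ) * ∑ p ∈ J, w p ^ 2 * (r h p : ℝ) ^ 2 := Finset.sum_le_sum hterm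
    _ = (J.card : ℝ) * ∑ p ∈ J, w p ^ 2 *
        ∑ h ∈ Finset.univ.erase (0 : ZMod q), (r h p : ℝ) ^ 2 := by
        rw [← Finset.mul_sum, Finset.sum_comm]
        simp_rw [Finset.mul_sum]
    _ ≤ (J.card : ℝ) * (J.card • (512 * ℓ * τ ^ 2 * (q * (x / √q + √q * √x)))) := by
        gcongr
        exact Finset.sum_le_card_nsmul _ _ _ hbox
    _ = (Λ : ℝ) ^ 4 * (512 * ℓ * τ ^ 2 * (q * (x / √q + √q * √x))) := by
        rw [hJ, Finset.card_product, Finset.card_range, nsmul_eq_mul]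
        push_cast; ring
    _ ≤ (2 * ℓ) ^ 4 * (512 * ℓ * τ ^ 2 * (q * (x / √q + √q * √x))) := by gcongr
    _ = _ := by ring

theorem sum_sq_sum_sqMulCount_le_card {q : ℕ} [NeZero q] (S : Finset ℕ) (M : ℕ → ℕ) (K j : ℕ)
    (hS : ∀ d ∈ S, 1 ≤ d ∧ d.Coprime q ∧ Nat.log 2 d = j ∧ M d ≤ K) :
    ∑ a : ZMod q, (∑ d ∈ S, sqMulCount q (M d) d a) ^ 2 ≤
      (sqCongrQuads q K (2 * 2 ^ j)).card := by
  set R : ZMod q → Finset ((_ : ℕ) × ℕ) := fun a => S.sigma fun d =>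
    (Finset.Icc 1 (M d)).filter fun m : ℕ => ((m * d ^ 2 : ℕ) : ZMod q) = a with hR
  have e : ∑ a : ZMod q, (∑ d ∈ S, sqMulCount q (M d) d a) ^ 2 =
      ((Finset.univ : Finset (ZMod q)).sigma fun a => R a ×ˢ R a).card := by
    rw [Finset.card_sigma]
    refine Finset.sum_congr rfl fun a _ => ?_
    rw [Finset.card_product, ← sq, hR, Finset.card_sigma]
    rfl
  rw [e]
  refine Finset.card_le_card_of_injOn
    (fun p => (((p.2.1.2 : ℤ), (p.2.2.2 : ℤ)), (p.2.2.1, p.2.1.1))) ?_ ?_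
  · rintro ⟨a, ⟨d₁, m₁⟩, d₂, m₂⟩ hp
    simp only [Finset.mem_coe, Finset.mem_sigma, Finset.mem_product, hR, Finset.mem_filter,
      Finset.mem_univ, true_and, Finset.mem_Icc] at hp
    obtain ⟨⟨h1, ⟨h2, h3⟩, h4⟩, h5, ⟨h6, h7⟩, h8⟩ := hp
    have hlt : ∀ d ∈ S, d ≤ 2 * 2 ^ j := fun d hd => by
      rw [← pow_succ', ← (hS d hd).2.2.1]; exact (Nat.lt_pow_succ_log_self one_lt_two d).le
    have hm₁ := h3.trans (hS _ h1).2.2.2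
    have hm₂ := h7.trans (hS _ h5).2.2.2
    simp only [Finset.mem_coe, mem_sqCongrQuads]
    refine ⟨⟨⟨by omega, by omega⟩, by omega, by omega⟩, ⟨⟨(hS _ h5).1, hlt _ h5⟩, (hS _ h1).1,
      hlt _ h1⟩, by omega, by omega, (hS _ h5).2.1, (hS _ h1).2.1, ?_⟩
    rw [← ZMod.intCast_zmod_eq_zero_iff_dvd]
    push_cast at h4 h8 ⊢
    rw [h4, h8, sub_self]
  · rintro ⟨a, ⟨d₁, m₁⟩, d₂, m₂⟩ hp ⟨a', ⟨d₁', m₁'⟩, d₂', m₂'⟩ hp' heq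
    simp only [Finset.mem_coe, Finset.mem_sigma, Finset.mem_product, hR, Finset.mem_filter,
      Finset.mem_univ, true_and] at hp hp'
    simp only [Prod.mk.injEq, Nat.cast_inj] at heq
    obtain ⟨⟨rfl, rfl⟩, rfl, rfl⟩ := heq
    obtain rfl : a = a' := hp.1.2.2.symm.trans hp'.1.2.2
    rfl

/-- The contribution of large `d`. -/
theorem sum_sq_sqMulCount_le {q : ℕ} [NeZero q] {x : ℝ} (hqx : (q : ℝ) ≤ x) (S : Finset ℕ)
    (hS : ∀ d ∈ S, 1 ≤ d ∧ d.Coprime q ∧ (d : ℝ) ≤ x ∧ x ≤ (d : ℝ) ^ 2 * √q) :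
    ∑ a : ZMod q, (∑ d ∈ S, (sqMulCount q ⌊x / (d : ℝ) ^ 2⌋₊ d a : ℝ)) ^ 2 ≤
      512 * (1 + Real.log x) ^ 3 * (q.divisors.card : ℝ) ^ 2 * (x / √q + √q * √x) := by
  have hq0 : 0 < q := Nat.pos_of_neZero q
  have hq1 : (1 : ℝ) ≤ q := by exact_mod_cast hq0
  have hq : (0 : ℝ) < q := by linarith
  have hx : 1 ≤ x := hq1.trans hqx
  have hx0 : 0 < x := by linarith
  have hsq : 1 ≤ √(q : ℝ) := Real.one_le_sqrt.2 hq1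
  have hℓ : 1 ≤ 1 + Real.log x := by linarith [Real.log_nonneg hx]
  obtain ⟨ℓ, hℓd⟩ : ∃ ℓ, ℓ = 1 + Real.log x := ⟨_, rfl⟩
  obtain ⟨τ, hτ⟩ : ∃ τ : ℝ, τ = (q.divisors.card : ℝ) := ⟨_, rfl⟩
  have hℓ0 : 0 ≤ ℓ := by rw [hℓd]; linarith
  set X := ⌊x⌋₊ with hX
  set Λ := Nat.log 2 X + 1 with hΛ
  have hmap : ∀ d ∈ S, Nat.log 2 d ∈ Finset.range Λ := fun d hd => by
    rw [Finset.mem_range, hΛ]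
    exact Nat.lt_succ_of_le (Nat.log_mono_right (Nat.le_floor (hS d hd).2.2.1))
  have hbox : ∀ j ∈ Finset.range Λ, ∑ a : ZMod q, (∑ d ∈ S.filter fun d => Nat.log 2 d = j,
      (sqMulCount q ⌊x / (d : ℝ) ^ 2⌋₊ d a : ℝ)) ^ 2 ≤
      128 * ℓ * τ ^ 2 * (x / √q + √q * √x) := by
    intro j _
    rcases (S.filter fun d => Nat.log 2 d = j).eq_empty_or_nonempty with h0 | ⟨d₀, hd₀⟩
    · rw [h0]
      simp only [Finset.sum_empty, ne_eq, OfNat.ofNat_ne_zero, not_false_eq_true, zero_pow,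
        Finset.sum_const_zero]
      positivity
    set K := ⌊min √(q : ℝ) (x / ((2 : ℝ) ^ j) ^ 2)⌋₊ with hK
    have hKle : (K : ℝ) ≤ min √(q : ℝ) (x / ((2 : ℝ) ^ j) ^ 2) :=
      Nat.floor_le (le_min (by positivity) (by positivity))
    have hK1 : (K : ℝ) ≤ √q := hKle.trans (min_le_left _ _)
    have hK2 : (K : ℝ) * ((2 : ℝ) ^ j) ^ 2 ≤ x := by
      rw [← le_div_iff₀ (by positivity)]
      exact hKle.trans (min_le_right _ _)
    have hKq : K ≤ q := by
      have : (K : ℝ) ≤ q := hK1.trans (by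
        rw [Real.sqrt_le_left hq.le]; nlinarith)
      exact_mod_cast this
    have hcount := sum_sq_sum_sqMulCount_le_card (q := q) (S.filter fun d => Nat.log 2 d = j)
      (fun d => ⌊x / (d : ℝ) ^ 2⌋₊) K j (by
        intro d hd
        rw [Finset.mem_filter] at hd
        obtain ⟨hd, hj⟩ := hd
        obtain ⟨h1, h2, h3, h4⟩ := hS d hd
        refine ⟨h1, h2, hj, Nat.floor_le_floor (le_min ?_ ?_)⟩
        · rw [div_le_iff₀ (by positivity)]; linarith
        · have : ((2 : ℝ) ^ j) ≤ d := by
            rw [← hj]; exact_mod_cast Nat.pow_log_le_self 2 (by omega)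
          gcongr)
    have hN := card_sqCongrQuads_le (D := 2 * 2 ^ j) hq0 hKq
    have hlog : 1 + Real.log ((2 * 2 ^ j : ℕ) : ℝ) ≤ 2 * ℓ := by
      rw [hℓd]
      refine one_add_log_dyadic_le (by positivity) ?_ hx
      rw [Finset.mem_filter] at hd₀
      push_cast
      refine le_trans ?_ (hS d₀ hd₀.1).2.2.1
      rw [← hd₀.2]
      exact_mod_cast Nat.pow_log_le_self 2 (by have := (hS d₀ hd₀.1).1; omega)
    push_cast at hN hlog
    have hbpos : (0 : ℝ) < 2 ^ j := by positivity
    have hcount' : ∑ a : ZMod q, (∑ d ∈ S.filter fun d => Nat.log 2 d = j,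
        (sqMulCount q ⌊x / (d : ℝ) ^ 2⌋₊ d a : ℝ)) ^ 2 ≤
        ((sqCongrQuads q K (2 * 2 ^ j)).card : ℝ) := by exact_mod_cast hcount
    have hK0 : (0 : ℝ) ≤ K := Nat.cast_nonneg K
    clear_value K
    generalize (2 : ℝ) ^ j = b at *
    have hmain : ((K : ℝ) ^ 2 * (2 * b) ^ 2 / q + K * √K * (2 * b)) ≤
        4 * (x / √q + √q * √x) := by
      have t1 : (K : ℝ) ^ 2 * (2 * b) ^ 2 / q ≤ 4 * (x / √q) := by
        calc (K : ℝ) ^ 2 * (2 * b) ^ 2 / q = 4 * (K * (K * b ^ 2) / q) := by ring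
          _ ≤ 4 * (√q * x / q) := by gcongr
          _ = 4 * (√q * x / (√q * √q)) := by rw [Real.mul_self_sqrt hq.le]
          _ = _ := by field_simp
      have t2 : K * √K * (2 * b) ≤ 4 * (√q * √x) := by
        have s : √((K : ℝ) * b ^ 2) ≤ √x := Real.sqrt_le_sqrt hK2
        rw [Real.sqrt_mul hK0, Real.sqrt_sq hbpos.le] at s
        calc K * √K * (2 * b) = 2 * (K * (√K * b)) := by ring
          _ ≤ 2 * (√q * √x) := by gcongr
          _ ≤ _ := by gcongr; norm_num
      linarith
    calc _ ≤ 16 * τ ^ 2 * (2 * ℓ) * (4 * (x / √q + √q * √x)) := by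
          refine hcount'.trans (hN.trans ?_)
          rw [← hτ]
          gcongr
      _ = _ := by ring
  have hΛ2 : (Λ : ℝ) ≤ 2 * ℓ := hℓd ▸ log_two_add_one_le hx le_rfl
  rw [← hℓd, ← hτ]
  calc _ ≤ ∑ a : ZMod q, (Λ : ℝ) * ∑ j ∈ Finset.range Λ,
        (∑ d ∈ S.filter fun d => Nat.log 2 d = j,
          (sqMulCount q ⌊x / (d : ℝ) ^ 2⌋₊ d a : ℝ)) ^ 2 := by
        refine Finset.sum_le_sum fun a _ => ?_
        rw [← Finset.sum_fiberwise_of_maps_to hmap]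
        refine sq_sum_le_card_mul_sum_sq.trans (le_of_eq ?_)
        rw [Finset.card_range]
    _ = (Λ : ℝ) * ∑ j ∈ Finset.range Λ, ∑ a : ZMod q,
        (∑ d ∈ S.filter fun d => Nat.log 2 d = j,
          (sqMulCount q ⌊x / (d : ℝ) ^ 2⌋₊ d a : ℝ)) ^ 2 := by
        rw [← Finset.mul_sum, Finset.sum_comm]
    _ ≤ (Λ : ℝ) * ((Finset.range Λ).card • (128 * ℓ * τ ^ 2 * (x / √q + √q * √x))) := by
        gcongr
        exact Finset.sum_le_card_nsmul _ _ _ hbox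
    _ = (Λ : ℝ) ^ 2 * (128 * ℓ * τ ^ 2 * (x / √q + √q * √x)) := by
        rw [Finset.card_range, nsmul_eq_mul]; ring
    _ ≤ (2 * ℓ) ^ 2 * (128 * ℓ * τ ^ 2 * (x / √q + √q * √x)) := by gcongr
    _ = _ := by ring

theorem abs_sum_perm_mul_sub_le {G : Type*} [Fintype G] [Nonempty G] (s : G → ℝ)
    (γ : Equiv.Perm G) (c : ℝ) :
    |∑ u, s (γ u) * s u - 1 / (Fintype.card G : ℝ) * (∑ u, s u) ^ 2| ≤
      2 * ∑ u, (s u - c) ^ 2 := by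
  have hn : (0 : ℝ) < Fintype.card G := by exact_mod_cast Fintype.card_pos
  obtain ⟨t, ht⟩ : ∃ t : G → ℝ, ∀ u, s u = t u + c := ⟨fun u => s u - c, fun u => by ring⟩
  have h1 : ∑ u, s u = ∑ u, t u + Fintype.card G * c := by
    simp_rw [ht]
    rw [Finset.sum_add_distrib, Finset.sum_const, nsmul_eq_mul, Finset.card_univ]
  have hγ1 : ∑ u, t (γ u) = ∑ u, t u := Equiv.sum_comp γ t
  have hγ2 : ∑ u, t (γ u) ^ 2 = ∑ u, t u ^ 2 := Equiv.sum_comp γ fun u => t u ^ 2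
  have h2 : ∑ u, s (γ u) * s u =
      ∑ u, t (γ u) * t u + 2 * c * ∑ u, t u + Fintype.card G * c ^ 2 := by
    have : ∀ u, s (γ u) * s u = t (γ u) * t u + (c * t (γ u) + c * t u) + c ^ 2 := fun u => by
      rw [ht, ht]; ring
    simp_rw [this]
    rw [Finset.sum_add_distrib, Finset.sum_add_distrib, Finset.sum_add_distrib, ← Finset.mul_sum,
      ← Finset.mul_sum, hγ1, Finset.sum_const, nsmul_eq_mul, Finset.card_univ]
    ring
  have h3 : ∑ u, (s u - c) ^ 2 = ∑ u, t u ^ 2 :=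
    Finset.sum_congr rfl fun u _ => by rw [ht]; ring
  have hA : |∑ u, t (γ u) * t u| ≤ ∑ u, t u ^ 2 := by
    calc _ ≤ ∑ u, |t (γ u) * t u| := Finset.abs_sum_le_sum_abs _ _
      _ ≤ ∑ u, (t (γ u) ^ 2 + t u ^ 2) / 2 := Finset.sum_le_sum fun u _ => by
          rw [abs_le]
          constructor <;> nlinarith [sq_nonneg (t (γ u) + t u), sq_nonneg (t (γ u) - t u)]
      _ = _ := by
          rw [← Finset.sum_div, Finset.sum_add_distrib, hγ2]; ring
  have hB : 1 / (Fintype.card G : ℝ) * (∑ u, t u) ^ 2 ≤ ∑ u, t u ^ 2 := by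
    rw [one_div, inv_mul_le_iff₀ hn]
    exact sq_sum_le_card_mul_sum_sq
  have hB0 : 0 ≤ 1 / (Fintype.card G : ℝ) * (∑ u, t u) ^ 2 := by positivity
  have h4 : ∑ u, s (γ u) * s u - 1 / (Fintype.card G : ℝ) * (∑ u, s u) ^ 2 =
      ∑ u, t (γ u) * t u - 1 / (Fintype.card G : ℝ) * (∑ u, t u) ^ 2 := by
    rw [h1, h2]
    field_simp
    ring
  rw [h3, h4]
  rw [abs_le] at hA ⊢
  constructor <;> linarith

/-- The number of squarefree `n ≤ x` in a residue class modulo `q`. -/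
noncomputable def sqfreeCount (x : ℝ) (q : ℕ) (a : ZMod q) : ℝ :=
  ∑ n ∈ (Finset.Icc 1 ⌊x⌋₊).filter (fun n : ℕ => (n : ZMod q) = a),
    |((ArithmeticFunction.moebius n : ℤ) : ℝ)|

theorem coprimeSqfreeSum_eq_sum (x : ℝ) (q : ℕ) [NeZero q] :
    coprimeSqfreeSum x q = ∑ u : (ZMod q)ˣ, sqfreeCount x q u := by
  classical
  simp only [coprimeSqfreeSum, sqfreeCount, Finset.sum_filter]
  rw [Finset.sum_comm]
  refine Finset.sum_congr rfl fun n _ => ?_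
  by_cases h : n.Coprime q
  · rw [if_pos h, Finset.sum_eq_single (ZMod.unitOfCoprime n h)]
    · simp
    · intro u _ hu
      refine if_neg fun h' => hu (Units.ext ?_)
      rw [← h', ZMod.coe_unitOfCoprime]
    · simp
  · rw [if_neg h]
    symm
    refine Finset.sum_eq_zero fun u _ => if_neg fun h' => h ?_
    rw [← ZMod.isUnit_iff_coprime, h']
    exact u.isUnit

theorem twistedPairSum_eq_sum (x : ℝ) (q : ℕ) [NeZero q] (γ : Equiv.Perm (ZMod q)ˣ) :
    twistedPairSum x q γ =
      ∑ u : (ZMod q)ˣ, sqfreeCount x q (γ u : (ZMod q)ˣ) * sqfreeCount x q u := by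
  classical
  simp only [twistedPairSum, sqfreeCount, Finset.sum_filter, Finset.sum_mul_sum]
  rw [Finset.sum_product]
  conv_rhs => rw [Finset.sum_comm]
  refine Finset.sum_congr rfl fun n₁ _ => ?_
  rw [Finset.sum_comm]
  refine Finset.sum_congr rfl fun n₂ _ => ?_
  by_cases h : ∃ (h₁ : n₁.Coprime q) (h₂ : n₂.Coprime q),
        ZMod.unitOfCoprime n₁ h₁ = γ (ZMod.unitOfCoprime n₂ h₂)
  · rw [if_pos h]
    obtain ⟨h₁, h₂, h₃⟩ := h
    rw [Finset.sum_eq_single (ZMod.unitOfCoprime n₂ h₂)]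
    · rw [← h₃]; simp
    · intro u _ hu
      rw [if_neg (c := (n₂ : ZMod q) = u), mul_zero]
      refine fun h' => hu (Units.ext ?_)
      rw [← h', ZMod.coe_unitOfCoprime]
    · simp
  · rw [if_neg h]
    symm
    refine Finset.sum_eq_zero fun u _ => ?_
    rw [mul_eq_zero, ite_eq_right_iff, ite_eq_right_iff]
    by_contra! h'
    obtain ⟨⟨e₁, -⟩, e₂, -⟩ := h'
    have h₁ : n₁.Coprime q := by
      rw [← ZMod.isUnit_iff_coprime, e₁]; exact Units.isUnit _
    have h₂ : n₂.Coprime q := by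
      rw [← ZMod.isUnit_iff_coprime, e₂]; exact Units.isUnit _
    refine h ⟨h₁, h₂, Units.ext ?_⟩
    have : ZMod.unitOfCoprime n₂ h₂ = u := Units.ext (by rw [ZMod.coe_unitOfCoprime, e₂])
    rw [this, ZMod.coe_unitOfCoprime, e₁]

theorem sqMulCount_eq_card (x : ℝ) (q d : ℕ) (hd : 0 < d) (a : ZMod q) :
    sqMulCount q ⌊x / (d : ℝ) ^ 2⌋₊ d a =
      ((Finset.Icc 1 ⌊x⌋₊).filter fun n : ℕ => (n : ZMod q) = a ∧ d ^ 2 ∣ n).card := by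
  have hd2 : 0 < d ^ 2 := pow_pos hd 2
  have hfl : ⌊x / (d : ℝ) ^ 2⌋₊ = ⌊x⌋₊ / d ^ 2 := by
    rw [← Nat.floor_div_natCast, Nat.cast_pow]
  rw [sqMulCount, hfl]
  refine Finset.card_bij (fun m _ => m * d ^ 2) ?_ ?_ ?_
  · intro m hm
    simp only [Finset.mem_filter, Finset.mem_Icc] at hm ⊢
    obtain ⟨⟨h1, h2⟩, h3⟩ := hm
    exact ⟨⟨Nat.mul_pos h1 hd2, (Nat.le_div_iff_mul_le hd2).1 h2⟩, h3, Dvd.intro_left _ rfl⟩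
  · intro m _ m' _ h
    exact Nat.eq_of_mul_eq_mul_right hd2 h
  · intro n hn
    simp only [Finset.mem_filter, Finset.mem_Icc] at hn
    obtain ⟨⟨h1, h2⟩, h3, m, rfl⟩ := hn
    refine ⟨m, ?_, mul_comm _ _⟩
    simp only [Finset.mem_filter, Finset.mem_Icc]
    rw [mul_comm] at h1 h2 h3
    exact ⟨⟨Nat.pos_of_mul_pos_right h1, (Nat.le_div_iff_mul_le hd2).2 h2⟩, h3⟩

theorem sqfreeCount_eq_sum (x : ℝ) (q : ℕ) (u : (ZMod q)ˣ) :
    sqfreeCount x q u = ∑ d ∈ (Finset.Icc 1 ⌊x⌋₊).filter (fun d => d.Coprime q),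
      ((ArithmeticFunction.moebius d : ℤ) : ℝ) * sqMulCount q ⌊x / (d : ℝ) ^ 2⌋₊ d u := by
  have h1 : sqfreeCount x q u = ∑ d ∈ Finset.Icc 1 ⌊x⌋₊,
      ((ArithmeticFunction.moebius d : ℤ) : ℝ) * sqMulCount q ⌊x / (d : ℝ) ^ 2⌋₊ d u := by
    have : ∀ n ∈ (Finset.Icc 1 ⌊x⌋₊).filter (fun n : ℕ => (n : ZMod q) = u),
        |((ArithmeticFunction.moebius n : ℤ) : ℝ)| = ∑ d ∈ Finset.Icc 1 ⌊x⌋₊,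
          if d ^ 2 ∣ n then ((ArithmeticFunction.moebius d : ℤ) : ℝ) else 0 := by
      intro n hn
      rw [Finset.mem_filter, Finset.mem_Icc] at hn
      rw [abs_moebius_eq_sum hn.1.1 hn.1.2, Finset.sum_filter]
    rw [sqfreeCount, Finset.sum_congr rfl this, Finset.sum_comm]
    refine Finset.sum_congr rfl fun d hd => ?_
    rw [← Finset.sum_filter, Finset.sum_const, Finset.filter_filter,
      sqMulCount_eq_card x q d (Finset.mem_Icc.1 hd).1, nsmul_eq_mul, mul_comm]
  rw [h1]
  symm
  refine Finset.sum_subset (Finset.filter_subset _ _) fun d hd hd' => ?_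
  have hc : ¬ d.Coprime q := fun h => hd' (Finset.mem_filter.2 ⟨hd, h⟩)
  have : sqMulCount q ⌊x / (d : ℝ) ^ 2⌋₊ d u = 0 := by
    rw [sqMulCount, Finset.card_eq_zero, Finset.filter_eq_empty_iff]
    intro m _ hm
    apply hc
    have hu : IsUnit ((m * d ^ 2 : ℕ) : ZMod q) := hm ▸ u.isUnit
    rw [ZMod.isUnit_iff_coprime] at hu
    exact Nat.Coprime.coprime_dvd_left ((dvd_pow_self d two_ne_zero).trans (dvd_mul_left _ m)) hu
  rw [this, Nat.cast_zero, mul_zero]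

/-- The variance of squarefree integers over the reduced residue classes modulo `q`. -/
theorem exists_sum_sq_sqfreeCount_sub_le {q : ℕ} [NeZero q] {x : ℝ} (hqx : (q : ℝ) ≤ x) :
    ∃ c : ℝ, ∑ u : (ZMod q)ˣ, (sqfreeCount x q u - c) ^ 2 ≤
      17408 * (1 + Real.log x) ^ 5 * (q.divisors.card : ℝ) ^ 2 * (x / √q + √q * √x) := by
  have hq1 : (1 : ℝ) ≤ q := by exact_mod_cast Nat.pos_of_neZero q
  have hq : (0 : ℝ) < q := by linarith
  have hx : 1 ≤ x := hq1.trans hqx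
  have hℓ : 1 ≤ 1 + Real.log x := by linarith [Real.log_nonneg hx]
  set T := (Finset.Icc 1 ⌊x⌋₊).filter (fun d => d.Coprime q) with hT
  set A := T.filter fun d : ℕ => (d : ℝ) ^ 2 * √q ≤ x with hA
  set B := T.filter fun d : ℕ => ¬ (d : ℝ) ^ 2 * √q ≤ x with hB
  set m : ℕ → ℝ := fun d => ((ArithmeticFunction.moebius d : ℤ) : ℝ) with hm
  have hm1 : ∀ d, |m d| ≤ 1 := fun d => by
    simp only [hm]
    exact_mod_cast ArithmeticFunction.abs_moebius_le_one
  set M : ℕ → ℕ := fun d => ⌊x / (d : ℝ) ^ 2⌋₊ with hM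
  have hTm : ∀ d ∈ T, 1 ≤ d ∧ d.Coprime q ∧ (d : ℝ) ≤ x := fun d hd => by
    rw [hT, Finset.mem_filter, Finset.mem_Icc] at hd
    exact ⟨hd.1.1, hd.2, (Nat.le_floor_iff (by linarith)).1 hd.1.2⟩
  set α : ZMod q → ℝ := fun a => ∑ d ∈ A, m d * ((sqMulCount q (M d) d a : ℝ) - M d / q) with hα
  set β : ZMod q → ℝ := fun a => ∑ d ∈ B, (sqMulCount q (M d) d a : ℝ) with hβ
  have hVA : ∑ a, α a ^ 2 ≤
      8192 * (1 + Real.log x) ^ 5 * (q.divisors.card : ℝ) ^ 2 * (x / √q + √q * √x) := by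
    refine (sum_sq_sqMulCount_sub_mean_le A M m hm1
      fun d hd => (hTm d (Finset.mem_filter.1 hd).1).2.1).trans ?_
    rw [one_div, inv_mul_le_iff₀ hq]
    refine (sum_sq_min_le hqx A fun d hd => ?_).trans (le_of_eq (by ring))
    obtain ⟨h1, h2⟩ := Finset.mem_filter.1 hd
    exact ⟨(hTm d h1).1, (hTm d h1).2.1, h2⟩
  have hVB : ∑ a, β a ^ 2 ≤
      512 * (1 + Real.log x) ^ 3 * (q.divisors.card : ℝ) ^ 2 * (x / √q + √q * √x) := by
    refine sum_sq_sqMulCount_le hqx B fun d hd => ?_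
    obtain ⟨h1, h2⟩ := Finset.mem_filter.1 hd
    exact ⟨(hTm d h1).1, (hTm d h1).2.1, (hTm d h1).2.2, (not_le.1 h2).le⟩
  refine ⟨∑ d ∈ A, m d * (M d / q), ?_⟩
  have hpt : ∀ u : (ZMod q)ˣ, (sqfreeCount x q u - ∑ d ∈ A, m d * (M d / q)) ^ 2 ≤
      2 * α u ^ 2 + 2 * β u ^ 2 := by
    intro u
    have e : sqfreeCount x q u - ∑ d ∈ A, m d * (M d / q) =
        α u + ∑ d ∈ B, m d * (sqMulCount q (M d) d (u : ZMod q) : ℝ) := by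
      rw [sqfreeCount_eq_sum, ← Finset.sum_filter_add_sum_filter_not T
        (fun d : ℕ => (d : ℝ) ^ 2 * √q ≤ x)]
      simp only [hα, mul_sub, Finset.sum_sub_distrib]
      ring
    have hb : |∑ d ∈ B, m d * (sqMulCount q (M d) d (u : ZMod q) : ℝ)| ≤ β u := by
      refine (Finset.abs_sum_le_sum_abs _ _).trans (Finset.sum_le_sum fun d _ => ?_)
      rw [abs_mul, Nat.abs_cast]
      exact mul_le_of_le_one_left (Nat.cast_nonneg _) (hm1 d)
    have hb2 := sq_le_sq' (neg_le_of_abs_le hb) (le_of_abs_le hb)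
    rw [e]
    refine (add_sq_le).trans ?_
    linarith
  have hunits : ∑ u : (ZMod q)ˣ, (2 * α u ^ 2 + 2 * β u ^ 2) ≤
      ∑ a : ZMod q, (2 * α a ^ 2 + 2 * β a ^ 2) := by
    have := Finset.sum_map Finset.univ
      ⟨fun u : (ZMod q)ˣ => (u : ZMod q), Units.val_injective⟩
      fun a => 2 * α a ^ 2 + 2 * β a ^ 2
    refine this.symm.le.trans ?_
    exact Finset.sum_le_sum_of_subset_of_nonneg (Finset.subset_univ _)
      fun a _ _ => by positivity
  have h35 : (1 + Real.log x) ^ 3 ≤ (1 + Real.log x) ^ 5 := pow_le_pow_right₀ hℓ (by norm_num)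
  have hVB' : 512 * (1 + Real.log x) ^ 3 * (q.divisors.card : ℝ) ^ 2 * (x / √q + √q * √x) ≤
      512 * (1 + Real.log x) ^ 5 * (q.divisors.card : ℝ) ^ 2 * (x / √q + √q * √x) := by
    gcongr
  refine (Finset.sum_le_sum fun u _ => hpt u).trans (hunits.trans ?_)
  rw [Finset.sum_add_distrib, ← Finset.mul_sum, ← Finset.mul_sum]
  linarith

theorem corollary6 (ε : ℝ) (hε : 0 < ε) :
    ∃ C : ℝ, 0 < C ∧ ∀ (q : ℕ) (x : ℝ), 1 ≤ q → (q : ℝ) ≤ x →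
      ∀ γ : Equiv.Perm (ZMod q)ˣ,
        |twistedPairSum x q γ - (1 / (Nat.totient q : ℝ)) * coprimeSqfreeSum x q ^ 2| ≤
          C * (x ^ ε * (x ^ (1 / 2 : ℝ) * (q : ℝ) ^ (1 / 2 : ℝ) + x / (q : ℝ) ^ (1 / 2 : ℝ))) := by
  have hδ : 0 < ε / 7 := by positivity
  obtain ⟨D, hD, hdiv⟩ := exists_card_divisors_le (ε / 7) hδ
  refine ⟨2 * (17408 * (1 + 1 / (ε / 7)) ^ 5 * D ^ 2), by positivity, fun q x hq1 hqx γ => ?_⟩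
  have : NeZero q := ⟨by omega⟩
  have hq : (1 : ℝ) ≤ q := by exact_mod_cast hq1
  have hx : 1 ≤ x := hq.trans hqx
  have hx0 : 0 < x := by linarith
  obtain ⟨c, hc⟩ := exists_sum_sq_sqfreeCount_sub_le hqx
  rw [twistedPairSum_eq_sum, coprimeSqfreeSum_eq_sum, ← ZMod.card_units_eq_totient]
  refine (abs_sum_perm_mul_sub_le (fun u : (ZMod q)ˣ => sqfreeCount x q u) γ c).trans ?_
  have hlog := one_add_log_le_rpow hδ hx
  have hlog0 : 0 ≤ 1 + Real.log x := by linarith [Real.log_nonneg hx]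
  have hτ : (q.divisors.card : ℝ) ≤ D * x ^ (ε / 7) := (hdiv q (by omega)).trans (by gcongr)
  have hpow : (x ^ (ε / 7)) ^ 7 = x ^ ε := by
    rw [← Real.rpow_mul_natCast hx0.le]
    congr 1
    push_cast
    ring
  simp only [← Real.sqrt_eq_rpow]
  calc 2 * ∑ u : (ZMod q)ˣ, (sqfreeCount x q u - c) ^ 2
      ≤ 2 * (17408 * (1 + Real.log x) ^ 5 * (q.divisors.card : ℝ) ^ 2 *
          (x / √q + √q * √x)) := by gcongr
    _ ≤ 2 * (17408 * ((1 + 1 / (ε / 7)) * x ^ (ε / 7)) ^ 5 * (D * x ^ (ε / 7)) ^ 2 *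
          (x / √q + √q * √x)) := by gcongr
    _ = 2 * (17408 * (1 + 1 / (ε / 7)) ^ 5 * D ^ 2) *
          ((x ^ (ε / 7)) ^ 7 * (√x * √q + x / √q)) := by ring
    _ = _ := by rw [hpow]
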